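/- For $n\ge 1$ let $X_n$ be a random $n\times n$ complex Hermitian matrix (i.e. $X_n(\omega)^*=X_n(\omega)$ for all $\omega$), defined on some probability space. Let $(d_n)_{n\ge1}$ be real numbers with $d_n=o(n^2)$ as $n\to\infty$, and assume: (i) for every $n$ there is a partition $\{P_1,\dots,P_k\}$ of $\{1,\dots,n\}\times\{1,\dots,n\}$ with $|P_r|\le d_n$ for all $r$ such that the random vectors $\big((X_n)_{ij}\big)_{(i,j)\in P_r}$, $r=1,\dots,k$, are independent; (ii) for every $\varepsilon>0$, $$\lim_{M\to\infty}\limsup_{n\to\infty}\mathbb P\Big(\frac1{n^2}\sum_{i,j=1}^n |(X_n)_{ij}|^2\,\mathbf 1_{\{|(X_n)_{ij}|>M\}}>\varepsilon\Big)=0 .$$ Let $L_n=\frac1n\sum_{i=1}^n\delta_{\lambda_i}$, where $\lambda_1\le\dots\le\lambda_n$ are the eigenvalues, with multiplicity, of $\frac1{\sqrt n}X_n$, and let $\mathbb E L_n$ be the deterministic probability measure on $\mathbb R$ given by $(\mathbb E L_n)(B)=\mathbb E\,(L_n(B))$ for Borel sets $B\subseteq\mathbb R$. Then, for every metric $d$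 on the set of Borel probability measures on $\mathbb R$ that metrizes weak convergence (that is, for all probability measures $\mu_k,\mu$, one has $d(\mu_k,\mu)\to0$ if and only if $\int f\,d\mu_k\to\int f\,d\mu$ for all bounded continuous $f:\mathbb R\to\mathbb R$), $$d(L_n,\mathbb E L_n)\to 0\quad\text{in probability as } n\to\infty .$$ In particular, if $\mathbb E L_n$ converges weakly to a probability measure $\mu$ on $\mathbb R$, then $L_n$ converges to $\mu$ weakly in probability, i.e. $d(L_n,\mu)\to0$ in probability for every metric $d$ that metrizes weak convergence. -/

import Mathlib

open Filter Topology MeasureTheory ProbabilityTheory Asymptotics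
open scoped ENNReal NNReal

/-- The real vector space of `n × n` complex Hermitian matrices. -/
abbrev HermMat (n : ℕ) : Type := selfAdjoint (Matrix (Fin n) (Fin n) ℂ)

theorem HermMat.isHermitian {n : ℕ} (A : HermMat n) :
    (A : Matrix (Fin n) (Fin n) ℂ).IsHermitian := A.2

/-- The eigenvalues of a Hermitian matrix, with multiplicity. -/
noncomputable def HermMat.eig {n : ℕ} (A : HermMat n) : Fin n → ℝ :=
  A.isHermitian.eigenvalues

/-- The measure `(1/n) ∑ᵢ δ_{λᵢ}`, where the `λᵢ` are the eigenvalues of `A`. -/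
noncomputable def esdMeasure {n : ℕ} (A : HermMat n) : Measure ℝ :=
  (n : ℝ≥0∞)⁻¹ • ∑ i, Measure.dirac (A.eig i)

theorem isProbabilityMeasure_esdMeasure {n : ℕ} [NeZero n] (A : HermMat n) :
    IsProbabilityMeasure (esdMeasure A) := by
  constructor
  simp only [esdMeasure, Measure.smul_apply, Measure.finsetSum_apply, measure_univ,
    Finset.sum_const, Finset.card_univ, Fintype.card_fin, nsmul_eq_mul, mul_one, smul_eq_mul]
  exact ENNReal.inv_mul_cancel (by exact_mod_cast NeZero.ne n) (ENNReal.natCast_ne_top n)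

/-- The empirical spectral distribution of a Hermitian matrix. -/
noncomputable def esd {n : ℕ} [NeZero n] (A : HermMat n) : ProbabilityMeasure ℝ :=
  ⟨esdMeasure A, isProbabilityMeasure_esdMeasure A⟩

theorem sum_eval_eig {n : ℕ} (A : HermMat n) (p : Polynomial ℝ) :
    ∑ i, p.eval (A.eig i) =
      (Polynomial.aeval (A : Matrix (Fin n) (Fin n) ℂ) p).trace.re := by
  have hA : IsSelfAdjoint (A : Matrix (Fin n) (Fin n) ℂ) := A.2
  rw [← cfc_polynomial (R := ℝ) p (A : Matrix (Fin n) (Fin n) ℂ) hA,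
    A.isHermitian.cfc_eq, Matrix.IsHermitian.cfc, Unitary.conjStarAlgAut_apply,
    Matrix.trace_mul_cycle]
  simp [HermMat.eig, Matrix.trace_diagonal]

theorem measurable_sum_eval_eig {Ω : Type*} [MeasurableSpace Ω] {n : ℕ} {X : Ω → HermMat n}
    (hX : ∀ i j, Measurable fun ω => (X ω : Matrix (Fin n) (Fin n) ℂ) i j)
    (p : Polynomial ℝ) : Measurable fun ω => ∑ i, p.eval ((X ω).eig i) := by
  have hc : Continuous fun B : Fin n → Fin n → ℂ =>
      (Polynomial.aeval (Matrix.of B) p).trace.re := by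
    have h1 : Continuous fun B : Matrix (Fin n) (Fin n) ℂ => Polynomial.aeval B p :=
      p.continuous_aeval
    exact Complex.continuous_re.comp (h1.matrix_trace)
  have hm : Measurable fun ω => (fun i j => (X ω : Matrix (Fin n) (Fin n) ℂ) i j) :=
    measurable_pi_iff.2 fun i => measurable_pi_iff.2 fun j => hX i j
  have := hc.measurable.comp hm
  simp only [sum_eval_eig]
  exact this

theorem measurable_sum_continuous_eig {Ω : Type*} [MeasurableSpace Ω] {n : ℕ}
    {X : Ω → HermMat n}
    (hX : ∀ i j, Measurable fun ω => (X ω : Matrix (Fin n) (Fin n) ℂ) i j)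
    {f : ℝ → ℝ} (hf : Continuous f) : Measurable fun ω => ∑ i, f ((X ω).eig i) := by
  have hp : ∀ k : ℕ, ∃ p : Polynomial ℝ, ∀ x ∈ Set.Icc (-(k : ℝ)) k,
      |p.eval x - f x| < 1 / ((k : ℝ) + 1) := fun k =>
    exists_polynomial_near_of_continuousOn _ _ f hf.continuousOn _ (by positivity)
  choose p hp using hp
  refine measurable_of_tendsto_metrizable (fun k => measurable_sum_eval_eig hX (p k)) ?_
  refine tendsto_pi_nhds.2 fun ω => tendsto_finsetSum _ fun i _ => ?_
  rw [tendsto_iff_dist_tendsto_zero]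
  refine squeeze_zero' (Eventually.of_forall fun _ => dist_nonneg) ?_
    (tendsto_one_div_add_atTop_nhds_zero_nat (𝕜 := ℝ))
  obtain ⟨N, hN⟩ := exists_nat_ge |(X ω).eig i|
  filter_upwards [eventually_ge_atTop N] with k hk
  have hk' : |(X ω).eig i| ≤ k := hN.trans (by exact_mod_cast hk)
  rw [Real.dist_eq]
  exact (hp k _ (abs_le.1 hk')).le

/-- If the entries of a random Hermitian matrix are measurable, then its empirical spectral
distribution is a random measure. -/
theorem measurable_esdMeasure {Ω : Type*} [MeasurableSpace Ω] {n : ℕ} {X : Ω → HermMat n}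
    (hX : ∀ i j, Measurable fun ω => (X ω : Matrix (Fin n) (Fin n) ℂ) i j) :
    Measurable fun ω => esdMeasure (X ω) := by
  have hfin : ∀ ω, IsFiniteMeasure (∑ i, Measure.dirac ((X ω).eig i)) := fun ω => inferInstance
  have key : Measurable fun ω => ∑ i, Measure.dirac ((X ω).eig i) := by
    have hcl : ∀ F : Set ℝ, IsClosed F →
        Measurable fun ω => (∑ i, Measure.dirac ((X ω).eig i)) F := by
      intro F hF
      have e : (fun ω => (∑ i, Measure.dirac ((X ω).eig i)) F) =
          fun ω => ENNReal.ofReal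
            (∑ i, ((F.indicator (fun _ => (1 : ℝ≥0)) ((X ω).eig i) : ℝ≥0) : ℝ)) := by
        funext ω
        rw [ENNReal.ofReal_sum_of_nonneg fun i _ => NNReal.coe_nonneg _,
          Measure.finsetSum_apply]
        refine Finset.sum_congr rfl fun i _ => ?_
        rw [Measure.dirac_apply' _ hF.measurableSet]
        by_cases h : (X ω).eig i ∈ F <;> simp [h]
      rw [e]
      refine ENNReal.measurable_ofReal.comp ?_
      have hδ : ∀ k : ℕ, (0 : ℝ) < 1 / ((k : ℝ) + 1) := fun k => by positivity
      refine measurable_of_tendsto_metrizable (fun k => measurable_sum_continuous_eig hX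
        (f := fun x => ((thickenedIndicator (hδ k) F x : ℝ≥0) : ℝ))
        (NNReal.continuous_coe.comp (thickenedIndicator (hδ k) F).continuous)) ?_
      refine tendsto_pi_nhds.2 fun ω => tendsto_finsetSum _ fun i _ => ?_
      have := tendsto_pi_nhds.1 (thickenedIndicator_tendsto_indicator_closure hδ
        (tendsto_one_div_add_atTop_nhds_zero_nat (𝕜 := ℝ)) F) ((X ω).eig i)
      rw [hF.closure_eq] at this
      exact (NNReal.continuous_coe.tendsto _).comp this
    exact Measurable.measure_of_isPiSystem
      (BorelSpace.measurable_eq.trans borel_eq_generateFrom_isClosed)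
      isPiSystem_isClosed (fun F hF => hcl F hF) (hcl Set.univ isClosed_univ)
  refine Measure.measurable_of_measurable_coe _ fun s hs => ?_
  simp only [esdMeasure, Measure.smul_apply, smul_eq_mul]
  exact ((Measure.measurable_coe hs).comp key).const_mul _

/-- The matrix `X / √n`. -/
noncomputable def HermMat.normalized {n : ℕ} (A : HermMat n) : HermMat n :=
  (Real.sqrt n)⁻¹ • A

theorem measurable_normalized {Ω : Type*} [MeasurableSpace Ω] {n : ℕ} {X : Ω → HermMat n}
    (hX : ∀ i j, Measurable fun ω => (X ω : Matrix (Fin n) (Fin n) ℂ) i j) (i j : Fin n) :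
    Measurable fun ω => ((X ω).normalized : Matrix (Fin n) (Fin n) ℂ) i j := by
  have : (fun ω => ((X ω).normalized : Matrix (Fin n) (Fin n) ℂ) i j) =
      fun ω => (Real.sqrt n)⁻¹ • (X ω : Matrix (Fin n) (Fin n) ℂ) i j := rfl
  rw [this]
  exact (continuous_const_smul ((Real.sqrt n)⁻¹)).measurable.comp (hX i j)

/-- The expected empirical spectral distribution of a random Hermitian matrix: the deterministic
probability measure `B ↦ 𝔼 (esd (X ω) B)`, see `expectedEsd_apply`. -/
noncomputable def expectedEsd {Ω : Type*} [MeasurableSpace Ω] (P : Measure Ω)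
    [IsProbabilityMeasure P] {n : ℕ} [NeZero n] (X : Ω → HermMat n)
    (hX : ∀ i j, Measurable fun ω => (X ω : Matrix (Fin n) (Fin n) ℂ) i j) :
    ProbabilityMeasure ℝ :=
  ⟨P.bind fun ω => esdMeasure (X ω),
    isProbabilityMeasure_bind (measurable_esdMeasure hX).aemeasurable
      (Eventually.of_forall fun ω => isProbabilityMeasure_esdMeasure (X ω))⟩

theorem expectedEsd_apply {Ω : Type*} [MeasurableSpace Ω] (P : Measure Ω)
    [IsProbabilityMeasure P] {n : ℕ} [NeZero n] (X : Ω → HermMat n)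
    (hX : ∀ i j, Measurable fun ω => (X ω : Matrix (Fin n) (Fin n) ℂ) i j)
    {B : Set ℝ} (hB : MeasurableSet B) :
    (expectedEsd P X hX : Measure ℝ) B = ∫⁻ ω, (esd (X ω) : Measure ℝ) B ∂P :=
  Measure.bind_apply hB (measurable_esdMeasure hX).aemeasurable

/-- Property `𝒮(d)`: the index set of the `n × m` random matrix `X` has a partition into blocks
of cardinality at most `d` such that the corresponding vectors of entries are independent. -/
def HasIndepBlocks {Ω : Type*} [MeasurableSpace Ω] (P : Measure Ω) {n m : ℕ}
    (X : Ω → Matrix (Fin n) (Fin m) ℂ) (d : ℝ) : Prop :=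
  ∃ Q : Finpartition (Finset.univ : Finset (Fin n × Fin m)),
    iIndepFun (fun (B : {B // B ∈ Q.parts}) (ω : Ω) (e : {e // e ∈ B.1}) => X ω e.1.1 e.1.2) P ∧
    ∀ B ∈ Q.parts, (B.card : ℝ) ≤ d

open Classical in
/-- The Lindeberg-type condition `𝓛` for a sequence of random matrices: for every `ε > 0`,
`lim_{M → ∞} limsup_{n → ∞} P(n⁻² ∑_{i,j} |X_{ij}|² 1_{|X_{ij}| > M} > ε) = 0`. -/
def LindebergCondition {Ω : ℕ+ → Type*} [∀ n, MeasurableSpace (Ω n)]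
    (P : ∀ n, Measure (Ω n)) (X : ∀ n : ℕ+, Ω n → Matrix (Fin n) (Fin n) ℂ) : Prop :=
  ∀ ε : ℝ, 0 < ε →
    Tendsto (fun M : ℝ => limsup (fun n : ℕ+ => P n {ω | ε <
        1 / ((n : ℕ) : ℝ) ^ 2 *
          ∑ i, ∑ j, if M < ‖X n ω i j‖ then ‖X n ω i j‖ ^ 2 else 0}) atTop)
      atTop (𝓝 0)

/-- Convergence to `0` in probability of a sequence of real random variables (each of which may
live on its own probability space). -/
def TendstoZeroInProbability {Ω : ℕ+ → Type*} [∀ n, MeasurableSpace (Ω n)]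
    (P : ∀ n, Measure (Ω n)) (Y : ∀ n, Ω n → ℝ) : Prop :=
  ∀ ε : ℝ, 0 < ε → Tendsto (fun n => P n {ω | ε < |Y n ω|}) atTop (𝓝 0)

/-- Weak convergence of probability measures on `ℝ`: convergence in the topology of
`ProbabilityMeasure ℝ`, see `weakTendsto_iff`. -/
def WeakTendsto {ι : Type*} (l : Filter ι) (u : ι → ProbabilityMeasure ℝ)
    (μ : ProbabilityMeasure ℝ) : Prop :=
  Tendsto u l (𝓝 μ)

theorem weakTendsto_iff {ι : Type*} {l : Filter ι} {u : ι → ProbabilityMeasure ℝ}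
    {μ : ProbabilityMeasure ℝ} :
    WeakTendsto l u μ ↔ ∀ f : BoundedContinuousFunction ℝ ℝ,
      Tendsto (fun i => ∫ x, f x ∂(u i : Measure ℝ)) l (𝓝 (∫ x, f x ∂(μ : Measure ℝ))) :=
  ProbabilityMeasure.tendsto_iff_forall_integral_tendsto

/-- The metric `D` on the set of probability measures on `ℝ` metrizes weak convergence. -/
def MetrizesWeakConvergence (D : MetricSpace (ProbabilityMeasure ℝ)) : Prop :=
  ∀ (u : ℕ → ProbabilityMeasure ℝ) (μ : ProbabilityMeasure ℝ),
    WeakTendsto atTop u μ ↔ Tendsto (fun k => D.dist (u k) μ) atTop (𝓝 0)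

/-- Weak convergence in probability of random probability measures `ν n` to the deterministic
probability measure `μ`: the distance of `ν n` to `μ` tends to `0` in probability, in every
metric that metrizes weak convergence. -/
def TendstoWeaklyInProbability {Ω : ℕ+ → Type*} [∀ n, MeasurableSpace (Ω n)]
    (P : ∀ n, Measure (Ω n)) (ν : ∀ n, Ω n → ProbabilityMeasure ℝ)
    (μ : ProbabilityMeasure ℝ) : Prop :=
  ∀ D : MetricSpace (ProbabilityMeasure ℝ), MetrizesWeakConvergence D →
    TendstoZeroInProbability P fun n ω => D.dist (ν n ω) μ

/-! It suffices to show that every linear statistic `n⁻¹ ∑ f(λᵢ)`, with `f` bounded continuous, is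
close to its mean in L¹. Tightness then turns this into closeness in any metric for weak
convergence. Three reductions lead to a smooth `f` and bounded entries: the Frobenius–Lipschitz
bound `sq_sum_eigenvalues_sub_le` and the Lindeberg condition allow truncation at a level `M`; a
second-moment bound makes the mean spectral measures tight; on a bounded interval `f` is replaced by
a smooth compactly supported function (`exists_smooth_approx`).

For truncated entries the Efron–Stein inequality bounds the variance by the summed squared effects
of resampling one block. The Lipschitz bound alone gives only O(1) for this sum. The gain comes from
a second-order expansion (`abs_sum_eigenvalues_taylor_le`). The linear term is `tr (f'(A) Δ)`; by
Cauchy–Schwarz its square involves only the entries of `f'(A)` in the resampled block, and over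
disjoint blocks these add up to `‖f'(A)‖² ≤ n L²` in Frobenius norm. The remainder is `O(‖Δ‖²)`.
Both contributions to the variance are `O(d / n²)` (`sum_sq_eig_piecewise_sub_le`).

Blocks need not be symmetric under transposition, so resampling one may destroy Hermitian symmetry.
The statistic is therefore extended to arbitrary arrays through `hermPart`, which fixes Hermitian
matrices. -/

/-! ### The Efron–Stein inequality for bounded functions on product spaces. -/

section EfronStein

variable {ι α : Type*} [DecidableEq ι]

/-- Exchange the coordinates in `s` of two points of a product space. -/
def swapOn (s : Finset ι) (p : (ι → α) × (ι → α)) : (ι → α) × (ι → α) :=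
  (s.piecewise p.2 p.1, s.piecewise p.1 p.2)

/-- Exchanging coordinate `i` interchanges the hybrids along `s` and along `insert i s`; this
identity and the next are the two halves of that symmetry. -/
theorem piecewise_swapOn_singleton {s : Finset ι} {i : ι} (hi : i ∉ s)
    (p : (ι → α) × (ι → α)) :
    s.piecewise (swapOn {i} p).2 (swapOn {i} p).1 = (insert i s).piecewise p.2 p.1 := by
  funext j
  by_cases hj : j = i
  · subst hj; simp [swapOn, hi]
  · by_cases hs : j ∈ s <;> simp [swapOn, hj, hs]

theorem insert_piecewise_swapOn_singleton {s : Finset ι} {i : ι} (hi : i ∉ s)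
    (p : (ι → α) × (ι → α)) :
    (insert i s).piecewise (swapOn {i} p).2 (swapOn {i} p).1 = s.piecewise p.2 p.1 := by
  funext j
  by_cases hj : j = i
  · subst hj; simp [swapOn, hi]
  · by_cases hs : j ∈ s <;> simp [swapOn, hj, hs]

theorem singleton_piecewise_swapOn {s : Finset ι} {i : ι} (hi : i ∉ s)
    (p : (ι → α) × (ι → α)) :
    ({i} : Finset ι).piecewise (swapOn s p).2 (swapOn s p).1 =
      (insert i s).piecewise p.2 p.1 := by
  funext j
  by_cases hj : j = i
  · subst hj; simp [swapOn, hi]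
  · by_cases hs : j ∈ s <;> simp [swapOn, hj, hs]

variable [MeasurableSpace α]

theorem measurable_piecewise_snd_fst (s : Finset ι) :
    Measurable fun p : (ι → α) × (ι → α) => s.piecewise p.2 p.1 := by
  refine measurable_pi_iff.2 fun i => ?_
  by_cases hi : i ∈ s
  · simpa [hi] using (by fun_prop : Measurable fun p : (ι → α) × (ι → α) => p.2 i)
  · simpa [hi] using (by fun_prop : Measurable fun p : (ι → α) × (ι → α) => p.1 i)

variable [Fintype ι]

/-- Regrouped by coordinates, the measure is a product of the symmetric measures `μ i × μ i`. -/
theorem measurePreserving_swapOn (μ : ι → Measure α) [∀ i, IsProbabilityMeasure (μ i)]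
    (s : Finset ι) :
    MeasurePreserving (swapOn s) ((Measure.pi μ).prod (Measure.pi μ))
      ((Measure.pi μ).prod (Measure.pi μ)) := by
  have h1 := measurePreserving_arrowProdEquivProdArrow α α ι μ μ
  have h2 : MeasurePreserving
      (fun (a : ι → α × α) i => (if i ∈ s then (Prod.swap : α × α → α × α) else id) (a i))
      (Measure.pi fun i => (μ i).prod (μ i)) (Measure.pi fun i => (μ i).prod (μ i)) := by
    refine measurePreserving_pi _ _ fun i => ?_
    by_cases hi : i ∈ s
    · simpa [hi] using Measure.measurePreserving_swap
    · simpa [hi] using MeasurePreserving.id _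
  have h3 := (h1.comp h2).comp (h1.symm _)
  convert h3 using 1
  funext p
  refine Prod.ext (funext fun i => ?_) (funext fun i => ?_) <;> by_cases hi : i ∈ s <;>
    simp [swapOn, hi, MeasurableEquiv.arrowProdEquivProdArrow, Equiv.arrowProdEquivProdArrow]

theorem integrable_of_measurable_of_bounded {Ω : Type*} [MeasurableSpace Ω] {P : Measure Ω}
    [IsFiniteMeasure P] {f : Ω → ℝ} (hf : Measurable f) {K : ℝ} (hK : ∀ ω, |f ω| ≤ K) :
    Integrable f P :=
  Integrable.of_bound hf.aestronglyMeasurable K (Eventually.of_forall hK)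

/-- The telescoping estimate behind the Efron–Stein inequality. -/
theorem integral_mul_sub_piecewise_le (μ : ι → Measure α) [∀ i, IsProbabilityMeasure (μ i)]
    {F : (ι → α) → ℝ} (hF : Measurable F) {K : ℝ} (hK : ∀ x, |F x| ≤ K) (s : Finset ι) :
    ∫ p, F p.1 * (F p.1 - F (s.piecewise p.2 p.1)) ∂(Measure.pi μ).prod (Measure.pi μ) ≤
      1 / 2 * ∑ i ∈ s, ∫ p, (F p.1 - F (({i} : Finset ι).piecewise p.2 p.1)) ^ 2
        ∂(Measure.pi μ).prod (Measure.pi μ) := by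
  set π := (Measure.pi μ).prod (Measure.pi μ) with hπ
  have hm : ∀ s : Finset ι, Measurable fun p : (ι → α) × (ι → α) => F (s.piecewise p.2 p.1) :=
    fun s => hF.comp (measurable_piecewise_snd_fst s)
  have hm1 : Measurable fun p : (ι → α) × (ι → α) => F p.1 := hF.comp measurable_fst
  have hb : ∀ x y z : ι → α, |F x * (F y - F z)| ≤ K * (K + K) := fun x y z => by
    rw [abs_mul]
    exact mul_le_mul (hK x) ((abs_sub _ _).trans (add_le_add (hK y) (hK z))) (abs_nonneg _)
      ((abs_nonneg _).trans (hK x))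
  have hb2 : ∀ x y : ι → α, |(F x - F y) ^ 2| ≤ (K + K) ^ 2 := fun x y => by
    rw [abs_pow]
    exact pow_le_pow_left₀ (abs_nonneg _) ((abs_sub _ _).trans (add_le_add (hK x) (hK y))) 2
  have hi3 : ∀ s t u : Finset ι, Integrable (fun p : (ι → α) × (ι → α) =>
      F (s.piecewise p.2 p.1) * (F (t.piecewise p.2 p.1) - F (u.piecewise p.2 p.1))) π :=
    fun s t u => integrable_of_measurable_of_bounded ((hm s).mul ((hm t).sub (hm u)))
      fun p => hb _ _ _
  have hi2 : ∀ s t : Finset ι, Integrable (fun p : (ι → α) × (ι → α) =>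
      (F (s.piecewise p.2 p.1) - F (t.piecewise p.2 p.1)) ^ 2) π :=
    fun s t => integrable_of_measurable_of_bounded (((hm s).sub (hm t)).pow_const 2)
      fun p => hb2 _ _
  -- Coordinates are resampled one at a time; each costs at most half of its own squared difference.
  induction s using Finset.induction_on with
  | empty => simp
  | insert i s his ih =>
    rw [Finset.sum_insert his, mul_add]
    have e1 : ∫ p, F p.1 * (F p.1 - F ((insert i s).piecewise p.2 p.1)) ∂π =
        ∫ p, F p.1 * (F p.1 - F (s.piecewise p.2 p.1)) ∂π +
        ∫ p, F p.1 * (F (s.piecewise p.2 p.1) - F ((insert i s).piecewise p.2 p.1)) ∂π := by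
      rw [← integral_add]
      · congr 1; funext p; ring
      · simpa using hi3 ∅ ∅ s
      · simpa using hi3 ∅ s (insert i s)
    -- Exchanging coordinate `i` flips the sign of the increment and moves the prefactor to the
    -- point with `i` resampled.
    have e2 : ∫ p, F p.1 * (F (s.piecewise p.2 p.1) - F ((insert i s).piecewise p.2 p.1)) ∂π =
        ∫ p, F (({i} : Finset ι).piecewise p.2 p.1) *
          (F ((insert i s).piecewise p.2 p.1) - F (s.piecewise p.2 p.1)) ∂π := by
      have hme : AEStronglyMeasurable (fun p : (ι → α) × (ι → α) => F p.1 *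
          (F (s.piecewise p.2 p.1) - F ((insert i s).piecewise p.2 p.1)))
          (π.map (swapOn {i})) := (hm1.mul ((hm s).sub (hm _))).aestronglyMeasurable
      have := integral_map (measurePreserving_swapOn μ {i}).measurable.aemeasurable hme
      rw [(measurePreserving_swapOn μ {i}).map_eq] at this
      rw [this]
      congr 1
      funext p
      rw [piecewise_swapOn_singleton his, insert_piecewise_swapOn_singleton his]
      rfl
    -- The hybrid along `s` has the law of the original point, so `swapOn s` removes it from the
    -- increment.
    have e3 : ∫ p, (F (s.piecewise p.2 p.1) - F ((insert i s).piecewise p.2 p.1)) ^ 2 ∂π =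
        ∫ p, (F p.1 - F (({i} : Finset ι).piecewise p.2 p.1)) ^ 2 ∂π := by
      have hme : AEStronglyMeasurable (fun p : (ι → α) × (ι → α) =>
          (F p.1 - F (({i} : Finset ι).piecewise p.2 p.1)) ^ 2)
          (π.map (swapOn s)) := ((hm1.sub (hm _)).pow_const 2).aestronglyMeasurable
      have := integral_map (measurePreserving_swapOn μ s).measurable.aemeasurable hme
      rw [(measurePreserving_swapOn μ s).map_eq] at this
      rw [this]
      congr 1
      funext p
      rw [singleton_piecewise_swapOn his]
      rfl
    -- The two equal integrals of `e2` add up to the integral of a product of two increments, and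
    -- `ab ≤ (a² + b²) / 2`.
    have e4 : ∫ p, F p.1 * (F (s.piecewise p.2 p.1) - F ((insert i s).piecewise p.2 p.1)) ∂π +
        ∫ p, F (({i} : Finset ι).piecewise p.2 p.1) *
          (F ((insert i s).piecewise p.2 p.1) - F (s.piecewise p.2 p.1)) ∂π ≤
        1 / 2 * (∫ p, (F p.1 - F (({i} : Finset ι).piecewise p.2 p.1)) ^ 2 ∂π +
          ∫ p, (F (s.piecewise p.2 p.1) - F ((insert i s).piecewise p.2 p.1)) ^ 2 ∂π) := by
      have a1 := hi3 ∅ s (insert i s)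
      have a2 := hi3 {i} (insert i s) s
      have a3 := hi2 ∅ {i}
      have a4 := hi2 s (insert i s)
      simp only [Finset.piecewise_empty] at a1 a3
      rw [← integral_add a1 a2, ← integral_add a3 a4, ← integral_const_mul]
      refine integral_mono (a1.add a2) ((a3.add a4).const_mul _) fun p => ?_
      nlinarith [sq_nonneg ((F p.1 - F (({i} : Finset ι).piecewise p.2 p.1)) -
        (F (s.piecewise p.2 p.1) - F ((insert i s).piecewise p.2 p.1)))]
    linarith

/-- The **Efron–Stein inequality**, under a deterministic bound on the sum of squared
differences. -/
theorem efronStein_pi (μ : ι → Measure α) [∀ i, IsProbabilityMeasure (μ i)]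
    {F : (ι → α) → ℝ} (hF : Measurable F) {K : ℝ} (hK : ∀ x, |F x| ≤ K) {c : ℝ}
    (hc : ∀ x y, ∑ i, (F x - F (({i} : Finset ι).piecewise y x)) ^ 2 ≤ c) :
    ∫ p, (F p.1 - F p.2) ^ 2 ∂(Measure.pi μ).prod (Measure.pi μ) ≤ c := by
  set π := (Measure.pi μ).prod (Measure.pi μ) with hπ
  have h := integral_mul_sub_piecewise_le μ hF hK Finset.univ
  simp only [Finset.piecewise_univ] at h
  have hm1 : Measurable fun p : (ι → α) × (ι → α) => F p.1 := hF.comp measurable_fst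
  have hm2 : Measurable fun p : (ι → α) × (ι → α) => F p.2 := hF.comp measurable_snd
  have hi : ∀ f g : (ι → α) × (ι → α) → ℝ, Measurable f → Measurable g →
      (∀ p, |f p| ≤ K) → (∀ p, |g p| ≤ K) → Integrable (fun p => f p * g p) π :=
    fun f g hf hg hf' hg' => integrable_of_measurable_of_bounded (hf.mul hg) (K := K * K)
      fun p => by
        rw [abs_mul]
        exact mul_le_mul (hf' p) (hg' p) (abs_nonneg _) ((abs_nonneg _).trans (hf' p))
  have i11 := hi _ _ hm1 hm1 (fun p => hK _) (fun p => hK _)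
  have i12 := hi _ _ hm1 hm2 (fun p => hK _) (fun p => hK _)
  have i22 := hi _ _ hm2 hm2 (fun p => hK _) (fun p => hK _)
  have e1 : ∫ p, F p.2 * F p.2 ∂π = ∫ p, F p.1 * F p.1 ∂π := by
    have := integral_prod_swap (μ := Measure.pi μ) (ν := Measure.pi μ)
      (fun p : (ι → α) × (ι → α) => F p.1 * F p.1)
    simpa using this
  -- The factor 2 cancels the 1/2 of the telescoping estimate.
  have e2 : ∫ p, (F p.1 - F p.2) ^ 2 ∂π = 2 * ∫ p, F p.1 * (F p.1 - F p.2) ∂π := by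
    have h1 : ∫ p, F p.1 * (F p.1 - F p.2) ∂π =
        ∫ p, F p.1 * F p.1 ∂π - ∫ p, F p.1 * F p.2 ∂π := by
      rw [← integral_sub i11 i12]; congr 1; funext p; ring
    have h2 : ∫ p, (F p.1 - F p.2) ^ 2 ∂π =
        ∫ p, F p.1 * F p.1 ∂π - 2 * ∫ p, F p.1 * F p.2 ∂π + ∫ p, F p.2 * F p.2 ∂π := by
      rw [← integral_const_mul, ← integral_sub i11 (i12.const_mul 2)]
      have i3 : Integrable (fun p => F p.1 * F p.1 - 2 * (F p.1 * F p.2)) π :=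
        i11.sub (i12.const_mul 2)
      rw [← integral_add i3 i22]
      congr 1; funext p; ring
    rw [h1, h2, e1]; ring
  have e3 : ∑ i, ∫ p, (F p.1 - F (({i} : Finset ι).piecewise p.2 p.1)) ^ 2 ∂π ≤ c := by
    have hint : ∀ i ∈ (Finset.univ : Finset ι), Integrable (fun p : (ι → α) × (ι → α) =>
        (F p.1 - F (({i} : Finset ι).piecewise p.2 p.1)) ^ 2) π := fun i _ =>
      integrable_of_measurable_of_bounded
        ((hm1.sub (hF.comp (measurable_piecewise_snd_fst {i}))).pow_const 2)
        (K := (K + K) ^ 2) fun p => by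
          rw [abs_pow]
          exact pow_le_pow_left₀ (abs_nonneg _)
            ((abs_sub _ _).trans (add_le_add (hK _) (hK _))) 2
    rw [← integral_finsetSum _ hint]
    refine (integral_mono (integrable_finsetSum _ hint) (integrable_const c)
      fun p => hc p.1 p.2).trans ?_
    simp
  rw [e2]
  linarith

/-- The mean absolute deviation of a function of independent random variables. -/
theorem integral_abs_sub_integral_le_sqrt {Ω : Type*} [MeasurableSpace Ω] {P : Measure Ω}
    [IsProbabilityMeasure P] {Y : ι → Ω → α} (hY : ∀ i, Measurable (Y i)) (hind : iIndepFun Y P)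
    {F : (ι → α) → ℝ} (hF : Measurable F) {K : ℝ} (hK : ∀ x, |F x| ≤ K) {c : ℝ}
    (hc : ∀ x y, ∑ i, (F x - F (({i} : Finset ι).piecewise y x)) ^ 2 ≤ c) :
    ∫ ω, |F (fun i => Y i ω) - ∫ ω', F (fun i => Y i ω') ∂P| ∂P ≤ Real.sqrt c := by
  have hYm : Measurable fun ω i => Y i ω := measurable_pi_iff.2 hY
  have hmap : P.map (fun ω i => Y i ω) = Measure.pi fun i => P.map (Y i) :=
    (iIndepFun_iff_map_fun_eq_pi_map fun i => (hY i).aemeasurable).1 hind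
  have : ∀ i, IsProbabilityMeasure (P.map (Y i)) := fun i =>
    Measure.isProbabilityMeasure_map (hY i).aemeasurable
  set ν := Measure.pi fun i => P.map (Y i) with hν
  have hES : ∫ p, (F p.1 - F p.2) ^ 2 ∂ν.prod ν ≤ c := efronStein_pi _ hF hK hc
  have e : ∀ G : (ι → α) → ℝ, Measurable G → ∫ ω, G (fun i => Y i ω) ∂P = ∫ x, G x ∂ν := by
    intro G hG
    rw [← hmap, integral_map hYm.aemeasurable hG.aestronglyMeasurable]
  rw [e F hF, e (fun x => |F x - ∫ y, F y ∂ν|) (hF.sub_const _).abs]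
  have hFi : Integrable F ν := integrable_of_measurable_of_bounded hF hK
  have hm1 : Measurable fun p : (ι → α) × (ι → α) => F p.1 := hF.comp measurable_fst
  have hm2 : Measurable fun p : (ι → α) × (ι → α) => F p.2 := hF.comp measurable_snd
  have hbd : ∀ x y, |F x - F y| ≤ K + K := fun x y =>
    (abs_sub _ _).trans (add_le_add (hK _) (hK _))
  have hint : Integrable (fun p : (ι → α) × (ι → α) => |F p.1 - F p.2|) (ν.prod ν) :=
    integrable_of_measurable_of_bounded (hm1.sub hm2).abs (K := K + K) fun p => by
      rw [abs_abs]; exact hbd _ _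
  have h1 : ∫ x, |F x - ∫ y, F y ∂ν| ∂ν ≤ ∫ p, |F p.1 - F p.2| ∂ν.prod ν := by
    rw [integral_prod _ hint]
    refine integral_mono (hFi.sub (integrable_const _)).abs hint.integral_prod_left fun x => ?_
    have : F x - ∫ y, F y ∂ν = ∫ y, (F x - F y) ∂ν := by
      rw [integral_sub (integrable_const _) hFi]; simp
    simp only [this]
    exact abs_integral_le_integral_abs
  refine h1.trans (Real.le_sqrt_of_sq_le (le_trans ?_ hES))
  -- Nonnegative variance supplies `(𝔼|Z|)² ≤ 𝔼 Z²`.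
  have hv := variance_nonneg (fun p : (ι → α) × (ι → α) => |F p.1 - F p.2|) (ν.prod ν)
  rw [variance_eq_sub] at hv
  · simp only [Pi.pow_apply, sq_abs] at hv
    linarith
  · exact MemLp.of_bound (hm1.sub hm2).abs.aestronglyMeasurable (K + K)
      (Eventually.of_forall fun p => by
        rw [Real.norm_eq_abs, abs_abs]; exact hbd _ _)

end EfronStein

/-! ### Comparison of the spectra of two Hermitian matrices. -/

section Spectral

open Matrix

variable {m : Type*} [Fintype m] {A B : Matrix m m ℂ}

theorem sum_sq_norm_eq_trace_mul_self (hA : A.IsHermitian) :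
    ∑ i, ∑ j, ‖A i j‖ ^ 2 = (A * A).trace.re := by
  rw [trace, Complex.re_sum]
  refine Finset.sum_congr rfl fun i _ => ?_
  rw [diag_apply, Matrix.mul_apply, Complex.re_sum]
  refine Finset.sum_congr rfl fun j _ => ?_
  rw [← hA.apply j i, RCLike.star_def, RCLike.mul_conj]
  norm_cast

variable [DecidableEq m]

/-- The squared moduli of the inner products of the eigenvectors of two Hermitian matrices. -/
noncomputable def eigenOverlap (hA : A.IsHermitian) (hB : B.IsHermitian) (i j : m) : ℝ :=
  ‖(star (hA.eigenvectorUnitary : Matrix m m ℂ) * (hB.eigenvectorUnitary : Matrix m m ℂ)) i j‖ ^ 2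

theorem eigenOverlap_nonneg (hA : A.IsHermitian) (hB : B.IsHermitian) (i j : m) :
    0 ≤ eigenOverlap hA hB i j := by
  unfold eigenOverlap; positivity

theorem sum_sq_norm_row_of_mul_star_eq_one {W : Matrix m m ℂ} (hW : W * star W = 1) (i : m) :
    ∑ j, ‖W i j‖ ^ 2 = 1 := by
  have h := congrFun (congrFun hW i) i
  simp only [Matrix.mul_apply, star_apply, RCLike.star_def, RCLike.mul_conj, one_apply_eq] at h
  exact Complex.ofReal_eq_one.1 (by push_cast; exact h)

/-- The overlaps are the squared moduli of the entries of a unitary matrix, hence doubly stochastic.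
-/
theorem sum_eigenOverlap_right (hA : A.IsHermitian) (hB : B.IsHermitian) (i : m) :
    ∑ j, eigenOverlap hA hB i j = 1 := by
  refine sum_sq_norm_row_of_mul_star_eq_one ?_ i
  rw [star_mul, star_star, mul_assoc, ← mul_assoc (hB.eigenvectorUnitary : Matrix m m ℂ),
    Unitary.mul_star_self_of_mem hB.eigenvectorUnitary.2, one_mul,
    Unitary.star_mul_self_of_mem hA.eigenvectorUnitary.2]

theorem eigenOverlap_comm (hA : A.IsHermitian) (hB : B.IsHermitian) (i j : m) :
    eigenOverlap hA hB i j = eigenOverlap hB hA j i := by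
  have : star (hA.eigenvectorUnitary : Matrix m m ℂ) * (hB.eigenvectorUnitary : Matrix m m ℂ) =
      star (star (hB.eigenvectorUnitary : Matrix m m ℂ) *
        (hA.eigenvectorUnitary : Matrix m m ℂ)) := by
    rw [star_mul, star_star]
  rw [eigenOverlap, eigenOverlap, this, star_apply, norm_star]

theorem sum_eigenOverlap_left (hA : A.IsHermitian) (hB : B.IsHermitian) (j : m) :
    ∑ i, eigenOverlap hA hB i j = 1 := by
  simp_rw [eigenOverlap_comm hA hB]
  exact sum_eigenOverlap_right hB hA j

/-- Diagonalising both matrices leaves `tr (D W E W*)` with `W = U* V`. Traces become double sums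
against one nonnegative weight, so scalar inequalities transfer term by term. -/
theorem trace_cfc_mul_cfc (hA : A.IsHermitian) (hB : B.IsHermitian) (φ ψ : ℝ → ℝ) :
    (hA.cfc φ * hB.cfc ψ).trace.re =
      ∑ i, ∑ j, φ (hA.eigenvalues i) * ψ (hB.eigenvalues j) * eigenOverlap hA hB i j := by
  set U := (hA.eigenvectorUnitary : Matrix m m ℂ) with hU
  set V := (hB.eigenvectorUnitary : Matrix m m ℂ) with hV
  set D : Matrix m m ℂ := diagonal (RCLike.ofReal ∘ φ ∘ hA.eigenvalues) with hD
  set E : Matrix m m ℂ := diagonal (RCLike.ofReal ∘ ψ ∘ hB.eigenvalues) with hE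
  have h : (hA.cfc φ * hB.cfc ψ).trace = (D * (star U * V) * (E * star (star U * V))).trace := by
    rw [Matrix.IsHermitian.cfc, Matrix.IsHermitian.cfc, Unitary.conjStarAlgAut_apply,
      Unitary.conjStarAlgAut_apply, star_mul, star_star]
    rw [← hU, ← hV, ← hD, ← hE, mul_assoc U, mul_assoc U, trace_mul_comm U]
    simp only [mul_assoc]
  rw [h, trace, Complex.re_sum]
  refine Finset.sum_congr rfl fun i _ => ?_
  rw [diag_apply, Matrix.mul_apply, Complex.re_sum]
  refine Finset.sum_congr rfl fun j _ => ?_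
  rw [hD, hE, diagonal_mul, diagonal_mul, star_apply, eigenOverlap, ← hU, ← hV]
  set w := (star U * V) i j
  have : (((RCLike.ofReal ∘ φ ∘ hA.eigenvalues) i * w *
      ((RCLike.ofReal ∘ ψ ∘ hB.eigenvalues) j * star w) : ℂ)) =
      ((φ (hA.eigenvalues i) * ψ (hB.eigenvalues j) * ‖w‖ ^ 2 : ℝ) : ℂ) := by
    have hw : w * star w = ((‖w‖ ^ 2 : ℝ) : ℂ) := by
      rw [RCLike.star_def, RCLike.mul_conj]; push_cast; rfl
    push_cast at hw ⊢
    rw [← hw]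
    simp only [Function.comp_apply, Complex.coe_algebraMap, RCLike.ofReal]
    ring
  rw [this, Complex.ofReal_re]

theorem cfc_id_eq (hA : A.IsHermitian) : hA.cfc (fun x => x) = A := by
  conv_rhs => rw [hA.spectral_theorem]
  rfl

theorem cfc_one_eq (hA : A.IsHermitian) : hA.cfc (fun _ => 1) = 1 := by
  have : (RCLike.ofReal ∘ (fun _ => (1 : ℝ)) ∘ hA.eigenvalues : m → ℂ) = fun _ => 1 := by
    funext i; simp
  rw [Matrix.IsHermitian.cfc, this, diagonal_one, map_one]

theorem cfc_mul_eq (hA : A.IsHermitian) (φ ψ : ℝ → ℝ) :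
    hA.cfc φ * hA.cfc ψ = hA.cfc (fun x => φ x * ψ x) := by
  rw [Matrix.IsHermitian.cfc, Matrix.IsHermitian.cfc, ← map_mul, diagonal_mul_diagonal,
    Matrix.IsHermitian.cfc]
  congr 2
  funext i
  simp

theorem isHermitian_cfc (hA : A.IsHermitian) (φ : ℝ → ℝ) : (hA.cfc φ).IsHermitian := by
  have h : IsSelfAdjoint (diagonal (RCLike.ofReal ∘ φ ∘ hA.eigenvalues) : Matrix m m ℂ) := by
    rw [isSelfAdjoint_iff, star_eq_conjTranspose, diagonal_conjTranspose]
    congr 1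
    funext i
    simp
  exact h.map (Unitary.conjStarAlgAut ℂ _ hA.eigenvectorUnitary)

theorem sum_eigenvalues_left (hA : A.IsHermitian) (hB : B.IsHermitian) (φ : ℝ → ℝ) :
    ∑ i, φ (hA.eigenvalues i) =
      ∑ i, ∑ j, φ (hA.eigenvalues i) * eigenOverlap hA hB i j := by
  simp_rw [← Finset.mul_sum, sum_eigenOverlap_right, mul_one]

theorem sum_eigenvalues_right (hA : A.IsHermitian) (hB : B.IsHermitian) (ψ : ℝ → ℝ) :
    ∑ j, ψ (hB.eigenvalues j) =
      ∑ i, ∑ j, ψ (hB.eigenvalues j) * eigenOverlap hA hB i j := by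
  rw [Finset.sum_comm]
  simp_rw [← Finset.mul_sum, sum_eigenOverlap_left, mul_one]

theorem sum_sq_norm_cfc (hA : A.IsHermitian) (φ : ℝ → ℝ) :
    ∑ i, ∑ j, ‖hA.cfc φ i j‖ ^ 2 = ∑ i, φ (hA.eigenvalues i) ^ 2 := by
  rw [sum_sq_norm_eq_trace_mul_self (isHermitian_cfc hA φ), cfc_mul_eq,
    ← mul_one (hA.cfc fun x => φ x * φ x), ← cfc_one_eq hA, trace_cfc_mul_cfc,
    sum_eigenvalues_left hA hA (fun x => φ x ^ 2)]
  simp only [mul_one, sq]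

theorem sum_sq_eigenvalues (hA : A.IsHermitian) :
    ∑ i, hA.eigenvalues i ^ 2 = ∑ i, ∑ j, ‖A i j‖ ^ 2 := by
  have := sum_sq_norm_cfc hA fun x => x
  rw [cfc_id_eq] at this
  exact this.symm

/-- Expanding `tr ((B - A)²)` gives the square of a scalar difference, term by term. This lets
eigenvalues be compared in Frobenius norm without ordering or matching them. -/
theorem sum_sq_norm_sub (hA : A.IsHermitian) (hB : B.IsHermitian) :
    ∑ i, ∑ j, ‖(B - A) i j‖ ^ 2 =
      ∑ i, ∑ j, (hB.eigenvalues j - hA.eigenvalues i) ^ 2 * eigenOverlap hA hB i j := by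
  rw [sum_sq_norm_eq_trace_mul_self (hB.sub hA)]
  have h1 : (B - A) * (B - A) = B * B - B * A - A * B + A * A := by noncomm_ring
  have hAB : (A * B).trace.re = ∑ i, ∑ j,
      hA.eigenvalues i * hB.eigenvalues j * eigenOverlap hA hB i j := by
    have := trace_cfc_mul_cfc hA hB (fun x => x) fun x => x
    rwa [cfc_id_eq, cfc_id_eq] at this
  rw [h1, trace_add, trace_sub, trace_sub, trace_mul_comm B A, Complex.add_re, Complex.sub_re,
    Complex.sub_re, ← sum_sq_norm_eq_trace_mul_self hA, ← sum_sq_norm_eq_trace_mul_self hB, hAB,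
    ← sum_sq_eigenvalues hA, ← sum_sq_eigenvalues hB,
    sum_eigenvalues_left hA hB (fun x => x ^ 2), sum_eigenvalues_right hA hB (fun x => x ^ 2)]
  simp only [← Finset.sum_sub_distrib, ← Finset.sum_add_distrib]
  refine Finset.sum_congr rfl fun i _ => Finset.sum_congr rfl fun j _ => ?_
  ring

/-- Second-order Taylor estimate for linear eigenvalue statistics. -/
theorem abs_sum_eigenvalues_taylor_le (hA : A.IsHermitian) (hB : B.IsHermitian) {f f' : ℝ → ℝ}
    {C : ℝ} (hf : ∀ a b, |f b - f a - f' a * (b - a)| ≤ C * (b - a) ^ 2) :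
    |∑ i, f (hB.eigenvalues i) - ∑ i, f (hA.eigenvalues i) -
      (hA.cfc f' * (B - A)).trace.re| ≤ C * ∑ i, ∑ j, ‖(B - A) i j‖ ^ 2 := by
  have h1 : (hA.cfc f' * B).trace.re = ∑ i, ∑ j,
      f' (hA.eigenvalues i) * hB.eigenvalues j * eigenOverlap hA hB i j := by
    have := trace_cfc_mul_cfc hA hB f' fun x => x
    rwa [cfc_id_eq] at this
  have h2 : (hA.cfc f' * A).trace.re = ∑ i, ∑ j,
      f' (hA.eigenvalues i) * hA.eigenvalues i * eigenOverlap hA hB i j := by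
    -- Writing the identity as a function of `B` puts this trace on the same weights as the others.
    have := trace_cfc_mul_cfc hA hB (fun x => f' x * x) fun _ => 1
    rw [cfc_one_eq, mul_one, ← cfc_mul_eq, cfc_id_eq] at this
    simpa using this
  rw [Matrix.mul_sub, trace_sub, Complex.sub_re, h1, h2, sum_sq_norm_sub hA hB,
    sum_eigenvalues_left hA hB f, sum_eigenvalues_right hA hB f, Finset.mul_sum]
  simp only [← Finset.sum_sub_distrib, Finset.mul_sum]
  refine (Finset.abs_sum_le_sum_abs _ _).trans (Finset.sum_le_sum fun i _ => ?_)
  refine (Finset.abs_sum_le_sum_abs _ _).trans (Finset.sum_le_sum fun j _ => ?_)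
  have h := mul_le_mul_of_nonneg_right (hf (hA.eigenvalues i) (hB.eigenvalues j))
    (eigenOverlap_nonneg hA hB i j)
  refine le_trans (le_of_eq ?_) (h.trans (le_of_eq (by ring)))
  rw [← abs_of_nonneg (eigenOverlap_nonneg hA hB i j), ← abs_mul,
    abs_of_nonneg (eigenOverlap_nonneg hA hB i j)]
  congr 1
  ring

/-- Linear eigenvalue statistics of Lipschitz functions are Lipschitz in the Frobenius norm. -/
theorem sq_sum_eigenvalues_sub_le (hA : A.IsHermitian) (hB : B.IsHermitian) {f : ℝ → ℝ}
    {L : ℝ} (hf : ∀ a b, |f b - f a| ≤ L * |b - a|) :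
    (∑ i, f (hB.eigenvalues i) - ∑ i, f (hA.eigenvalues i)) ^ 2 ≤
      L ^ 2 * Fintype.card m * ∑ i, ∑ j, ‖(B - A) i j‖ ^ 2 := by
  rw [sum_sq_norm_sub hA hB, sum_eigenvalues_left hA hB f, sum_eigenvalues_right hA hB f]
  simp only [← Finset.sum_sub_distrib, ← sub_mul]
  simp only [← Fintype.sum_prod_type']
  -- Cauchy–Schwarz with the weight split as `√w · √w`; its total mass is the dimension.
  have hcs := Finset.sum_mul_sq_le_sq_mul_sq Finset.univ
    (fun x : m × m => Real.sqrt (eigenOverlap hA hB x.1 x.2))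
    (fun x : m × m => (f (hB.eigenvalues x.2) - f (hA.eigenvalues x.1)) *
      Real.sqrt (eigenOverlap hA hB x.1 x.2))
  have hs : ∀ x : m × m, Real.sqrt (eigenOverlap hA hB x.1 x.2) ^ 2 =
      eigenOverlap hA hB x.1 x.2 := fun x => Real.sq_sqrt (eigenOverlap_nonneg hA hB _ _)
  have h1 : ∑ x : m × m, eigenOverlap hA hB x.1 x.2 = Fintype.card m := by
    rw [Fintype.sum_prod_type]
    simp [sum_eigenOverlap_right]
  simp only [mul_pow, hs, h1] at hcs
  refine le_trans (le_of_eq ?_) (hcs.trans ?_)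
  · congr 1
    refine Finset.sum_congr rfl fun x _ => ?_
    rw [mul_left_comm, ← sq, hs]
  · rw [mul_comm (L ^ 2), mul_assoc]
    refine mul_le_mul_of_nonneg_left ?_ (Nat.cast_nonneg (α := ℝ) (Fintype.card m))
    rw [Finset.mul_sum]
    refine Finset.sum_le_sum fun x _ => ?_
    rw [← mul_assoc]
    refine mul_le_mul_of_nonneg_right ?_ (eigenOverlap_nonneg hA hB _ _)
    have := pow_le_pow_left₀ (abs_nonneg _) (hf (hA.eigenvalues x.1) (hB.eigenvalues x.2)) 2
    rwa [mul_pow, sq_abs, sq_abs] at this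

end Spectral

/-! ### Resampling blocks of a truncated Hermitian matrix. -/

section Blocks

variable {n : ℕ}

/-- The Hermitian part of the matrix with entries `y`. -/
noncomputable def hermPart (y : Fin n × Fin n → ℂ) : HermMat n :=
  ⟨Matrix.of fun i j => (y (i, j) + star (y (j, i))) / 2, by
    rw [selfAdjoint.mem_iff]
    ext i j
    simp [Matrix.star_apply, add_comm]⟩

theorem hermPart_apply (y : Fin n × Fin n → ℂ) (i j : Fin n) :
    (hermPart y : Matrix (Fin n) (Fin n) ℂ) i j = (y (i, j) + star (y (j, i))) / 2 := rfl

theorem norm_hermPart_apply_le (y : Fin n × Fin n → ℂ) (i j : Fin n) :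
    ‖(hermPart y : Matrix (Fin n) (Fin n) ℂ) i j‖ ≤ (‖y (i, j)‖ + ‖y (j, i)‖) / 2 := by
  rw [hermPart_apply, norm_div]
  have := norm_add_le (y (i, j)) (star (y (j, i)))
  rw [norm_star] at this
  simpa using div_le_div_of_nonneg_right this zero_le_two

theorem sum_sq_norm_hermPart_le (y : Fin n × Fin n → ℂ) :
    ∑ i, ∑ j, ‖(hermPart y : Matrix (Fin n) (Fin n) ℂ) i j‖ ^ 2 ≤ ∑ e, ‖y e‖ ^ 2 := by
  have h : ∀ i j, ‖(hermPart y : Matrix (Fin n) (Fin n) ℂ) i j‖ ^ 2 ≤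
      (‖y (i, j)‖ ^ 2 + ‖y (j, i)‖ ^ 2) / 2 := fun i j => by
    have := pow_le_pow_left₀ (norm_nonneg _) (norm_hermPart_apply_le y i j) 2
    nlinarith [sq_nonneg (‖y (i, j)‖ - ‖y (j, i)‖)]
  refine (Finset.sum_le_sum fun i _ => Finset.sum_le_sum fun j _ => h i j).trans (le_of_eq ?_)
  simp only [← Finset.sum_div, Finset.sum_add_distrib]
  rw [Finset.sum_comm (f := fun i j => ‖y (j, i)‖ ^ 2), Fintype.sum_prod_type]
  ring

/-- Since `‖G i j‖ = ‖G j i‖`, the reflected half of the Hermitian part folds back onto the position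
of `y e`. Hence only the entries of `G` on the support of `y` matter, even if that support is not
symmetric. -/
theorem abs_trace_mul_hermPart_le {G : Matrix (Fin n) (Fin n) ℂ} (hG : G.IsHermitian)
    (y : Fin n × Fin n → ℂ) :
    |(G * (hermPart y : Matrix (Fin n) (Fin n) ℂ)).trace.re| ≤
      ∑ e : Fin n × Fin n, ‖G e.1 e.2‖ * ‖y e‖ := by
  have hG' : ∀ i j, ‖G i j‖ = ‖G j i‖ := fun i j => by rw [← hG.apply j i, norm_star]
  refine (Complex.abs_re_le_norm _).trans ?_
  rw [Matrix.trace]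
  refine (norm_sum_le _ _).trans ?_
  have h : ∀ i, ‖(G * (hermPart y : Matrix (Fin n) (Fin n) ℂ)) i i‖ ≤
      ∑ j, ‖G i j‖ * ((‖y (j, i)‖ + ‖y (i, j)‖) / 2) := fun i => by
    rw [Matrix.mul_apply]
    refine (norm_sum_le _ _).trans (Finset.sum_le_sum fun j _ => ?_)
    rw [norm_mul]
    exact mul_le_mul_of_nonneg_left (norm_hermPart_apply_le y j i) (norm_nonneg _)
  refine (Finset.sum_le_sum fun i _ => h i).trans (le_of_eq ?_)
  have e : ∑ i, ∑ j, ‖G i j‖ * ‖y (j, i)‖ = ∑ i, ∑ j, ‖G i j‖ * ‖y (i, j)‖ := by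
    rw [Finset.sum_comm]
    exact Finset.sum_congr rfl fun i _ => Finset.sum_congr rfl fun j _ => by rw [hG' j i]
  simp only [← mul_div_assoc, mul_add, ← Finset.sum_div, Finset.sum_add_distrib]
  rw [e, Fintype.sum_prod_type]
  ring

theorem normalized_hermPart_sub (x y : Fin n × Fin n → ℂ) :
    ((hermPart y).normalized : Matrix (Fin n) (Fin n) ℂ) - (hermPart x).normalized =
      (((Real.sqrt n)⁻¹ : ℝ) : ℂ) • (hermPart (y - x) : Matrix (Fin n) (Fin n) ℂ) := by
  ext i j
  change ((Real.sqrt n)⁻¹ : ℝ) • (hermPart y : Matrix (Fin n) (Fin n) ℂ) i j -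
    ((Real.sqrt n)⁻¹ : ℝ) • (hermPart x : Matrix (Fin n) (Fin n) ℂ) i j =
      (((Real.sqrt n)⁻¹ : ℝ) : ℂ) * (hermPart (y - x) : Matrix (Fin n) (Fin n) ℂ) i j
  simp only [hermPart_apply, Complex.real_smul, Pi.sub_apply, star_sub]
  ring

theorem sum_sq_norm_normalized_sub_le (x y : Fin n × Fin n → ℂ) :
    ∑ i, ∑ j, ‖(((hermPart y).normalized : Matrix (Fin n) (Fin n) ℂ) -
      (hermPart x).normalized) i j‖ ^ 2 ≤ (n : ℝ)⁻¹ * ∑ e, ‖y e - x e‖ ^ 2 := by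
  rw [normalized_hermPart_sub]
  simp only [Matrix.smul_apply, norm_smul, mul_pow, ← Finset.mul_sum]
  rw [Complex.norm_real, Real.norm_eq_abs, sq_abs, inv_pow, Real.sq_sqrt (Nat.cast_nonneg n)]
  exact mul_le_mul_of_nonneg_left (sum_sq_norm_hermPart_le (y - x)) (by positivity)

/-- The change of a linear eigenvalue statistic when the entries in `s` are changed. -/
theorem sq_sum_eig_piecewise_sub_le {f f' : ℝ → ℝ} {C M : ℝ}
    (hf : ∀ a b, |f b - f a - f' a * (b - a)| ≤ C * (b - a) ^ 2)
    {x y : Fin n × Fin n → ℂ} (hx : ∀ e, ‖x e‖ ≤ M) (hy : ∀ e, ‖y e‖ ≤ M)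
    (s : Finset (Fin n × Fin n)) :
    (∑ i, f ((hermPart x).normalized.eig i) -
      ∑ i, f ((hermPart (s.piecewise y x)).normalized.eig i)) ^ 2 ≤
    2 * ((∑ e ∈ s, ‖(hermPart x).normalized.isHermitian.cfc f' e.1 e.2‖ ^ 2) *
        (4 * M ^ 2 * s.card / n) + (C * (4 * M ^ 2 * s.card / n)) ^ 2) := by
  set A := (hermPart x).normalized with hA
  set B := (hermPart (s.piecewise y x)).normalized with hB
  set G := A.isHermitian.cfc f' with hG
  have hT := abs_sum_eigenvalues_taylor_le A.isHermitian B.isHermitian hf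
  have hC : 0 ≤ C := by
    have := (abs_nonneg _).trans (hf 0 1)
    simpa using this
  have hM : ∀ e, ‖y e - x e‖ ^ 2 ≤ 4 * M ^ 2 := fun e => by
    have := pow_le_pow_left₀ (norm_nonneg _) ((norm_sub_le _ _).trans (add_le_add (hy e) (hx e))) 2
    linarith
  have hδ : ∑ e, ‖s.piecewise y x e - x e‖ ^ 2 = ∑ e ∈ s, ‖y e - x e‖ ^ 2 := by
    rw [← Finset.sum_subset (Finset.subset_univ s)]
    · exact Finset.sum_congr rfl fun e he => by rw [Finset.piecewise_eq_of_mem _ _ _ he]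
    · intro e _ he
      simp [Finset.piecewise_eq_of_notMem _ _ _ he]
  have hδ' : ∑ e ∈ s, ‖y e - x e‖ ^ 2 ≤ 4 * M ^ 2 * s.card := by
    refine (Finset.sum_le_sum fun e _ => hM e).trans (le_of_eq ?_)
    rw [Finset.sum_const, nsmul_eq_mul, mul_comm]
  have hfro : ∑ i, ∑ j, ‖((B : Matrix (Fin n) (Fin n) ℂ) - A) i j‖ ^ 2 ≤
      4 * M ^ 2 * s.card / n := by
    refine (sum_sq_norm_normalized_sub_le _ _).trans ?_
    rw [hδ, div_eq_inv_mul]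
    exact mul_le_mul_of_nonneg_left hδ' (by positivity)
  -- Cauchy–Schwarz is applied on `s` only: the factor `∑ e ∈ s, ‖G e‖²` must stay local to be
  -- summed over disjoint blocks later.
  have htr : (G * ((B : Matrix (Fin n) (Fin n) ℂ) - A)).trace.re ^ 2 ≤
      (∑ e ∈ s, ‖G e.1 e.2‖ ^ 2) * (4 * M ^ 2 * s.card / n) := by
    rw [hA, hB, normalized_hermPart_sub, Matrix.mul_smul, Matrix.trace_smul, smul_eq_mul,
      Complex.re_ofReal_mul, mul_pow, inv_pow, Real.sq_sqrt (Nat.cast_nonneg n)]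
    have h1 := abs_trace_mul_hermPart_le (isHermitian_cfc A.isHermitian f') (s.piecewise y x - x)
    have h2 : ∑ e : Fin n × Fin n, ‖G e.1 e.2‖ * ‖(s.piecewise y x - x) e‖ =
        ∑ e ∈ s, ‖G e.1 e.2‖ * ‖y e - x e‖ := by
      rw [← Finset.sum_subset (Finset.subset_univ s)]
      · exact Finset.sum_congr rfl fun e he => by
          rw [Pi.sub_apply, Finset.piecewise_eq_of_mem _ _ _ he]
      · intro e _ he
        simp [Finset.piecewise_eq_of_notMem _ _ _ he]
    rw [← hG, h2] at h1
    have h3 := pow_le_pow_left₀ (abs_nonneg _) h1 2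
    rw [sq_abs] at h3
    have h4 := h3.trans (Finset.sum_mul_sq_le_sq_mul_sq s _ _)
    have h5 := h4.trans (mul_le_mul_of_nonneg_left hδ'
      (Finset.sum_nonneg fun e _ => sq_nonneg _))
    refine (mul_le_mul_of_nonneg_left h5 (by positivity : (0 : ℝ) ≤ (n : ℝ)⁻¹)).trans
      (le_of_eq ?_)
    ring
  set t := (G * ((B : Matrix (Fin n) (Fin n) ℂ) - A)).trace.re with ht
  set r := ∑ i, f (B.eig i) - ∑ i, f (A.eig i) - t with hr
  have hr2 : r ^ 2 ≤ (C * (4 * M ^ 2 * s.card / n)) ^ 2 := by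
    rw [← sq_abs]
    refine pow_le_pow_left₀ (abs_nonneg _) (le_trans hT ?_) 2
    exact mul_le_mul_of_nonneg_left hfro hC
  have e : ∑ i, f (A.eig i) - ∑ i, f (B.eig i) = -(t + r) := by rw [hr]; ring
  rw [e]
  nlinarith [sq_nonneg (t - r)]

/-- The sum over the blocks of `Q` of the squared changes of a linear eigenvalue statistic. -/
theorem sum_sq_eig_piecewise_sub_le {f f' : ℝ → ℝ} {C L M d : ℝ} (hd : 0 ≤ d)
    (hf : ∀ a b, |f b - f a - f' a * (b - a)| ≤ C * (b - a) ^ 2) (hL : ∀ a, |f' a| ≤ L)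
    {x y : Fin n × Fin n → ℂ} (hx : ∀ e, ‖x e‖ ≤ M) (hy : ∀ e, ‖y e‖ ≤ M)
    (Q : Finpartition (Finset.univ : Finset (Fin n × Fin n)))
    (hQ : ∀ B ∈ Q.parts, (B.card : ℝ) ≤ d) [NeZero n] :
    ∑ B : {B // B ∈ Q.parts}, ((n : ℝ)⁻¹ * ∑ i, f ((hermPart x).normalized.eig i) -
      (n : ℝ)⁻¹ * ∑ i, f ((hermPart (B.1.piecewise y x)).normalized.eig i)) ^ 2 ≤
    (8 * L ^ 2 * M ^ 2 + 32 * C ^ 2 * M ^ 4) * (d / n ^ 2) := by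
  have hn : (0 : ℝ) < n := by exact_mod_cast Nat.pos_of_ne_zero (NeZero.ne n)
  set A := (hermPart x).normalized with hA
  set g : Fin n × Fin n → ℝ := fun e => ‖A.isHermitian.cfc f' e.1 e.2‖ ^ 2 with hg
  -- One factor `B.card` is bounded by `d` in each term; what remains, `∑ e ∈ B, g e` and one more
  -- `B.card`, is additive over the partition.
  have hterm : ∀ B : {B // B ∈ Q.parts}, ((n : ℝ)⁻¹ * ∑ i, f (A.eig i) -
      (n : ℝ)⁻¹ * ∑ i, f ((hermPart (B.1.piecewise y x)).normalized.eig i)) ^ 2 ≤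
      8 * M ^ 2 * d / n ^ 3 * ∑ e ∈ B.1, g e + 32 * C ^ 2 * M ^ 4 * d / n ^ 4 * B.1.card := by
    intro B
    have h := sq_sum_eig_piecewise_sub_le hf hx hy B.1
    have hB := hQ B.1 B.2
    have hg0 : 0 ≤ ∑ e ∈ B.1, g e := Finset.sum_nonneg fun e _ => sq_nonneg _
    rw [← mul_sub, mul_pow]
    refine (mul_le_mul_of_nonneg_left h (by positivity)).trans ?_
    have h1 : (∑ e ∈ B.1, g e) * (4 * M ^ 2 * B.1.card / n) ≤
        (∑ e ∈ B.1, g e) * (4 * M ^ 2 * d / n) := by gcongr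
    have h2 : (C * (4 * M ^ 2 * B.1.card / n)) ^ 2 ≤
        16 * C ^ 2 * M ^ 4 * d / n ^ 2 * B.1.card := by
      have : (C * (4 * M ^ 2 * B.1.card / n)) ^ 2 =
          16 * C ^ 2 * M ^ 4 / n ^ 2 * B.1.card * B.1.card := by field_simp; ring
      rw [this]
      calc _ ≤ 16 * C ^ 2 * M ^ 4 / n ^ 2 * B.1.card * d := by gcongr
        _ = _ := by ring
    calc ((n : ℝ)⁻¹) ^ 2 * (2 * ((∑ e ∈ B.1, g e) * (4 * M ^ 2 * B.1.card / n) +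
          (C * (4 * M ^ 2 * B.1.card / n)) ^ 2))
        ≤ ((n : ℝ)⁻¹) ^ 2 * (2 * ((∑ e ∈ B.1, g e) * (4 * M ^ 2 * d / n) +
          16 * C ^ 2 * M ^ 4 * d / n ^ 2 * B.1.card)) := by gcongr
      _ = _ := by field_simp; ring
  refine (Finset.sum_le_sum fun B _ => hterm B).trans ?_
  have hsum : ∀ φ : Fin n × Fin n → ℝ, ∑ B : {B // B ∈ Q.parts}, ∑ e ∈ B.1, φ e = ∑ e, φ e := by
    intro φ
    rw [Finset.sum_coe_sort Q.parts (fun B => ∑ e ∈ B, φ e)]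
    have := Finset.sum_biUnion (f := φ) Q.disjoint
    rw [Q.biUnion_parts] at this
    exact this.symm
  have hcard : ∑ B : {B // B ∈ Q.parts}, (B.1.card : ℝ) = n ^ 2 := by
    have := hsum fun _ => 1
    simp only [Finset.sum_const, nsmul_eq_mul, mul_one, Finset.card_univ, Fintype.card_prod,
      Fintype.card_fin, Nat.cast_mul] at this
    rw [this, sq]
  -- The squared Frobenius norm of `f'(A)` is a sum of only `n` eigenvalue terms, although it has
  -- `n²` entries.
  have hgs : ∑ e, g e ≤ n * L ^ 2 := by
    rw [hg, Fintype.sum_prod_type, sum_sq_norm_cfc]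
    refine (Finset.sum_le_sum fun i _ => ?_).trans_eq
      (b := ∑ _i : Fin n, L ^ 2) (by simp)
    rw [← sq_abs]
    exact pow_le_pow_left₀ (abs_nonneg _) (hL _) 2
  rw [Finset.sum_add_distrib, ← Finset.mul_sum, ← Finset.mul_sum, hsum, hcard]
  calc 8 * M ^ 2 * d / n ^ 3 * ∑ e, g e + 32 * C ^ 2 * M ^ 4 * d / n ^ 4 * (n : ℝ) ^ 2
      ≤ 8 * M ^ 2 * d / n ^ 3 * (n * L ^ 2) + 32 * C ^ 2 * M ^ 4 * d / n ^ 4 * (n : ℝ) ^ 2 := by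
        gcongr
    _ = _ := by field_simp

/-- Truncation of a complex number at level `M`. -/
noncomputable def truncAt (M : ℝ) (z : ℂ) : ℂ := if ‖z‖ ≤ M then z else 0

theorem norm_truncAt_le {M : ℝ} (hM : 0 ≤ M) (z : ℂ) : ‖truncAt M z‖ ≤ M := by
  unfold truncAt; split_ifs with h <;> simp [h, hM]

theorem measurable_truncAt (M : ℝ) : Measurable (truncAt M) :=
  Measurable.ite (measurableSet_le measurable_norm measurable_const) measurable_id
    measurable_const

/-- The Hermitian matrix with truncated entries. -/
noncomputable def HermMat.trunc (M : ℝ) (A : HermMat n) : HermMat n :=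
  hermPart fun e => truncAt M ((A : Matrix (Fin n) (Fin n) ℂ) e.1 e.2)

theorem hermPart_coe (A : HermMat n) :
    hermPart (fun e => (A : Matrix (Fin n) (Fin n) ℂ) e.1 e.2) = A := by
  refine Subtype.ext (Matrix.ext fun i j => ?_)
  rw [hermPart_apply, A.isHermitian.apply i j]
  ring

theorem measurable_normalized_hermPart {S : Type*} [MeasurableSpace S]
    {x : S → Fin n × Fin n → ℂ} (hx : ∀ e, Measurable fun s => x s e) (i j : Fin n) :
    Measurable fun s => ((hermPart (x s)).normalized : Matrix (Fin n) (Fin n) ℂ) i j := by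
  refine measurable_normalized (fun i j => ?_) i j
  simp only [hermPart_apply]
  exact ((hx _).add (continuous_star.measurable.comp (hx _))).div_const 2

/-- Concentration of linear eigenvalue statistics of truncated random matrices with independent
blocks. -/
theorem integral_abs_trunc_sub_le {Ω : Type*} [MeasurableSpace Ω] {P : Measure Ω}
    [IsProbabilityMeasure P] [NeZero n] {X : Ω → HermMat n}
    (hX : ∀ i j, Measurable fun ω => (X ω : Matrix (Fin n) (Fin n) ℂ) i j) {d : ℝ}
    (hS : HasIndepBlocks P (fun ω => (X ω : Matrix (Fin n) (Fin n) ℂ)) d)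
    {f f' : ℝ → ℝ} {C L M K : ℝ} (hfc : Continuous f) (hK : ∀ a, |f a| ≤ K)
    (hf : ∀ a b, |f b - f a - f' a * (b - a)| ≤ C * (b - a) ^ 2) (hL : ∀ a, |f' a| ≤ L)
    (hM : 0 ≤ M) :
    ∫ ω, |(n : ℝ)⁻¹ * ∑ i, f (((X ω).trunc M).normalized.eig i) -
      ∫ ω', (n : ℝ)⁻¹ * ∑ i, f (((X ω').trunc M).normalized.eig i) ∂P| ∂P ≤
    Real.sqrt ((8 * L ^ 2 * M ^ 2 + 32 * C ^ 2 * M ^ 4) * (d / n ^ 2)) := by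
  obtain ⟨Q, hind, hQ⟩ := hS
  have hn : (0 : ℝ) < n := by exact_mod_cast Nat.pos_of_ne_zero (NeZero.ne n)
  have hd : 0 ≤ d := by
    have h0 : Q.part (0, 0) ∈ Q.parts := by simp
    exact (Nat.cast_nonneg _).trans (hQ _ h0)
  set ι := {B // B ∈ Q.parts}
  let bl : Fin n × Fin n → ι := fun e => ⟨Q.part e, by simp⟩
  have hbl : ∀ e (B : ι), bl e = B ↔ e ∈ B.1 := by
    intro e B
    constructor
    · rintro rfl
      exact Q.mem_part (Finset.mem_univ e)
    · intro he
      exact Subtype.ext (Q.part_eq_of_mem B.2 he)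
  -- Blocks are extended by zero so that all of them take values in one space, as the Efron–Stein
  -- lemma requires.
  let Y : ι → Ω → (Fin n × Fin n → ℂ) := fun B ω e =>
    if e ∈ B.1 then (X ω : Matrix (Fin n) (Fin n) ℂ) e.1 e.2 else 0
  have hYm : ∀ B, Measurable (Y B) := fun B => by
    refine measurable_pi_iff.2 fun e => ?_
    by_cases he : e ∈ B.1
    · simpa only [Y, he, if_true] using hX e.1 e.2
    · simp only [Y, he, if_false]
      exact measurable_const
  have hYi : iIndepFun Y P := by
    have h := hind.comp (fun B (v : {e // e ∈ B.1} → ℂ) (e : Fin n × Fin n) =>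
      if he : e ∈ B.1 then v ⟨e, he⟩ else 0) fun B => by
        refine measurable_pi_iff.2 fun e => ?_
        by_cases he : e ∈ B.1
        · simpa only [he, dif_pos] using measurable_pi_apply _
        · simp only [he, dif_neg, not_false_iff]
          exact measurable_const
    refine h.congr fun B => Eventually.of_forall fun ω => funext fun e => ?_
    by_cases he : e ∈ B.1 <;> simp [Y, he]
  -- Each entry is read off its own block. Truncating inside `a` bounds the array by `M` for every
  -- argument `u`, as the resampling bound needs.
  let a : (ι → Fin n × Fin n → ℂ) → Fin n × Fin n → ℂ := fun u e => truncAt M (u (bl e) e)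
  let F : (ι → Fin n × Fin n → ℂ) → ℝ := fun u =>
    (n : ℝ)⁻¹ * ∑ i, f ((hermPart (a u)).normalized.eig i)
  have hFm : Measurable F := by
    refine (measurable_sum_continuous_eig (measurable_normalized_hermPart fun e => ?_)
      hfc).const_mul _
    exact (measurable_truncAt M).comp ((measurable_pi_apply e).comp (measurable_pi_apply (bl e)))
  have hFK : ∀ u, |F u| ≤ K := fun u => by
    rw [abs_mul, abs_inv, Nat.abs_cast]
    have h1 : |∑ i, f ((hermPart (a u)).normalized.eig i)| ≤ n * K := by
      refine (Finset.abs_sum_le_sum_abs _ _).trans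
        ((Finset.sum_le_sum fun i _ => hK _).trans_eq ?_)
      simp
    refine (mul_le_mul_of_nonneg_left h1 (by positivity)).trans_eq ?_
    field_simp
  have ha : ∀ u v (B : ι), a (({B} : Finset ι).piecewise v u) = B.1.piecewise (a v) (a u) := by
    intro u v B
    funext e
    by_cases he : e ∈ B.1
    · have := (hbl e B).2 he
      simp [a, he, this]
    · have : bl e ≠ B := fun h => he ((hbl e B).1 h)
      simp [a, he, this]
  have key := integral_abs_sub_integral_le_sqrt hYm hYi hFm hFK
    (c := (8 * L ^ 2 * M ^ 2 + 32 * C ^ 2 * M ^ 4) * (d / n ^ 2)) fun u v => by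
      simp only [F, ha]
      exact sum_sq_eig_piecewise_sub_le hd hf hL (fun e => norm_truncAt_le hM _)
        (fun e => norm_truncAt_le hM _) Q hQ
  have haX : ∀ ω, a (fun B => Y B ω) =
      fun e => truncAt M ((X ω : Matrix (Fin n) (Fin n) ℂ) e.1 e.2) := by
    intro ω
    funext e
    have : e ∈ Q.part e := Q.mem_part (Finset.mem_univ e)
    simp [a, Y, bl, this]
  simp only [F, haX] at key
  exact key

end Blocks

/-! ### Truncation error, tails and approximation of linear statistics. -/

section LinearStatistics

variable {n : ℕ}

/-- The linear eigenvalue statistic `(1/n) ∑ᵢ f(λᵢ)`. -/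
noncomputable def linStat (f : ℝ → ℝ) (A : HermMat n) : ℝ := (n : ℝ)⁻¹ * ∑ i, f (A.eig i)

/-- The sum `n⁻² ∑ |A_{ij}|² 1_{|A_{ij}| > M}`. -/
noncomputable def largeEntrySum (M : ℝ) (A : HermMat n) : ℝ :=
  1 / (n : ℝ) ^ 2 * ∑ i, ∑ j, if M < ‖(A : Matrix (Fin n) (Fin n) ℂ) i j‖ then
    ‖(A : Matrix (Fin n) (Fin n) ℂ) i j‖ ^ 2 else 0

theorem measurable_largeEntrySum {Ω : Type*} [MeasurableSpace Ω] {X : Ω → HermMat n}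
    (hX : ∀ i j, Measurable fun ω => (X ω : Matrix (Fin n) (Fin n) ℂ) i j) (M : ℝ) :
    Measurable fun ω => largeEntrySum M (X ω) := by
  unfold largeEntrySum
  refine (Finset.measurable_fun_sum _ fun i _ => Finset.measurable_fun_sum _ fun j _ =>
    ?_).const_mul _
  exact Measurable.ite (measurableSet_lt measurable_const (hX i j).norm)
    ((hX i j).norm.pow_const 2) measurable_const

theorem measurable_linStat {Ω : Type*} [MeasurableSpace Ω] {X : Ω → HermMat n}
    (hX : ∀ i j, Measurable fun ω => (X ω : Matrix (Fin n) (Fin n) ℂ) i j) {f : ℝ → ℝ}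
    (hf : Continuous f) : Measurable fun ω => linStat f (X ω) :=
  (measurable_sum_continuous_eig hX hf).const_mul _

theorem integral_esdMeasure (A : HermMat n) (f : ℝ → ℝ) :
    ∫ x, f x ∂esdMeasure A = linStat f A := by
  rw [esdMeasure, integral_smul_measure, integral_finsetSum_measure]
  · simp [linStat]
  · exact fun i _ => integrable_dirac (by simp)

/-- The squared Frobenius error of truncation is exactly `n²` times the Lindeberg sum, and all
powers of `n` cancel. -/
theorem sq_linStat_trunc_sub_le [NeZero n] {f : ℝ → ℝ} {L : ℝ}
    (hf : ∀ a b, |f b - f a| ≤ L * |b - a|) {M : ℝ} (A : HermMat n) :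
    (linStat f A.normalized - linStat f (A.trunc M).normalized) ^ 2 ≤
      L ^ 2 * largeEntrySum M A := by
  have hn : (0 : ℝ) < n := by exact_mod_cast Nat.pos_of_ne_zero (NeZero.ne n)
  have h1 := sq_sum_eigenvalues_sub_le (A.trunc M).normalized.isHermitian
    A.normalized.isHermitian hf
  have h2 := sum_sq_norm_normalized_sub_le
    (fun e => truncAt M ((A : Matrix (Fin n) (Fin n) ℂ) e.1 e.2))
    (fun e => (A : Matrix (Fin n) (Fin n) ℂ) e.1 e.2)
  rw [hermPart_coe] at h2
  have h3 : ∑ e : Fin n × Fin n, ‖(A : Matrix (Fin n) (Fin n) ℂ) e.1 e.2 -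
      truncAt M ((A : Matrix (Fin n) (Fin n) ℂ) e.1 e.2)‖ ^ 2 =
      n ^ 2 * largeEntrySum M A := by
    rw [Fintype.sum_prod_type, largeEntrySum, ← mul_assoc, mul_one_div_cancel (by positivity),
      one_mul]
    refine Finset.sum_congr rfl fun i _ => Finset.sum_congr rfl fun j _ => ?_
    unfold truncAt
    by_cases h : M < ‖(A : Matrix (Fin n) (Fin n) ℂ) i j‖
    · simp [h, not_le.2 h]
    · simp [h, not_lt.1 h]
  rw [h3] at h2
  rw [Fintype.card_fin] at h1
  have h4 := h1.trans (mul_le_mul_of_nonneg_left h2 (by positivity))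
  rw [linStat, linStat, ← mul_sub, mul_pow]
  refine (mul_le_mul_of_nonneg_left h4 (by positivity)).trans_eq ?_
  field_simp

theorem abs_linStat_le [NeZero n] {f : ℝ → ℝ} {K : ℝ} (hK : ∀ a, |f a| ≤ K) (A : HermMat n) :
    |linStat f A| ≤ K := by
  have hn : (0 : ℝ) < n := by exact_mod_cast Nat.pos_of_ne_zero (NeZero.ne n)
  rw [linStat, abs_mul, abs_inv, Nat.abs_cast]
  have h1 : |∑ i, f (A.eig i)| ≤ n * K := by
    refine (Finset.abs_sum_le_sum_abs _ _).trans
      ((Finset.sum_le_sum fun i _ => hK _).trans_eq ?_)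
    simp
  refine (mul_le_mul_of_nonneg_left h1 (by positivity)).trans_eq ?_
  field_simp

theorem integrable_linStat {Ω : Type*} [MeasurableSpace Ω] {P : Measure Ω} [IsFiniteMeasure P]
    [NeZero n] {X : Ω → HermMat n}
    (hX : ∀ i j, Measurable fun ω => (X ω : Matrix (Fin n) (Fin n) ℂ) i j) {f : ℝ → ℝ}
    (hf : Continuous f) {K : ℝ} (hK : ∀ a, |f a| ≤ K) :
    Integrable (fun ω => linStat f (X ω)) P :=
  integrable_of_measurable_of_bounded (measurable_linStat hX hf) fun _ => abs_linStat_le hK _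

theorem measurable_trunc_normalized {Ω : Type*} [MeasurableSpace Ω] {X : Ω → HermMat n}
    (hX : ∀ i j, Measurable fun ω => (X ω : Matrix (Fin n) (Fin n) ℂ) i j) (M : ℝ) (i j : Fin n) :
    Measurable fun ω => (((X ω).trunc M).normalized : Matrix (Fin n) (Fin n) ℂ) i j :=
  measurable_normalized_hermPart (fun e => (measurable_truncAt M).comp (hX e.1 e.2)) i j

/-- The Lipschitz bound is used where the Lindeberg sum is at most `ε`, and the trivial bound `2K`
elsewhere. -/
theorem integral_abs_linStat_trunc_sub_le {Ω : Type*} [MeasurableSpace Ω] {P : Measure Ω}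
    [IsProbabilityMeasure P] [NeZero n] {X : Ω → HermMat n}
    (hX : ∀ i j, Measurable fun ω => (X ω : Matrix (Fin n) (Fin n) ℂ) i j)
    {f : ℝ → ℝ} {L K : ℝ} (hL : 0 ≤ L) (hfc : Continuous f) (hK : ∀ a, |f a| ≤ K)
    (hf : ∀ a b, |f b - f a| ≤ L * |b - a|) (M : ℝ) {ε : ℝ} :
    ∫ ω, |linStat f (X ω).normalized - linStat f ((X ω).trunc M).normalized| ∂P ≤
      L * Real.sqrt ε + (K + K) * P.real {ω | ε < largeEntrySum M (X ω)} := by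
  have hS : MeasurableSet {ω | ε < largeEntrySum M (X ω)} :=
    measurableSet_lt measurable_const (measurable_largeEntrySum hX M)
  have hK0 : 0 ≤ K := (abs_nonneg _).trans (hK 0)
  have hb : ∀ ω, |linStat f (X ω).normalized - linStat f ((X ω).trunc M).normalized| ≤
      L * Real.sqrt ε +
        {ω | ε < largeEntrySum M (X ω)}.indicator (fun _ => K + K) ω := by
    intro ω
    by_cases h : ε < largeEntrySum M (X ω)
    · rw [Set.indicator_of_mem (by exact h)]
      have := (abs_sub (linStat f (X ω).normalized) (linStat f ((X ω).trunc M).normalized)).trans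
        (add_le_add (abs_linStat_le hK _) (abs_linStat_le hK _))
      have h0 : 0 ≤ L * Real.sqrt ε := by positivity
      linarith
    · rw [Set.indicator_of_notMem (by exact h), add_zero]
      refine (Real.abs_le_sqrt (sq_linStat_trunc_sub_le (M := M) hf (X ω))).trans ?_
      rw [Real.sqrt_mul (sq_nonneg L), Real.sqrt_sq hL]
      exact mul_le_mul_of_nonneg_left (Real.sqrt_le_sqrt (not_lt.1 h)) hL
  have hi : Integrable ({ω | ε < largeEntrySum M (X ω)}.indicator fun _ => K + K) P :=
    (integrable_const _).indicator hS
  refine (integral_mono ((integrable_linStat (measurable_normalized hX) hfc hK).sub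
    (integrable_linStat (measurable_trunc_normalized hX M) hfc hK)).abs
    ((integrable_const _).add hi) hb).trans_eq ?_
  simp only [Pi.add_apply]
  rw [integral_add (integrable_const _) hi, integral_indicator_const _ hS]
  simp [mul_comm]

/-- The approximation error enters twice, once for the variable and once for its mean. -/
theorem integral_abs_sub_integral_le {Ω : Type*} [MeasurableSpace Ω] {P : Measure Ω}
    [IsProbabilityMeasure P] {Z W : Ω → ℝ} (hZ : Integrable Z P) (hW : Integrable W P) :
    ∫ ω, |Z ω - ∫ ω', Z ω' ∂P| ∂P ≤
      2 * ∫ ω, |Z ω - W ω| ∂P + ∫ ω, |W ω - ∫ ω', W ω' ∂P| ∂P := by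
  have h1 : |∫ ω, Z ω ∂P - ∫ ω, W ω ∂P| ≤ ∫ ω, |Z ω - W ω| ∂P := by
    rw [← integral_sub hZ hW]
    exact abs_integral_le_integral_abs
  have hb : ∀ ω, |Z ω - ∫ ω', Z ω' ∂P| ≤
      |Z ω - W ω| + |W ω - ∫ ω', W ω' ∂P| + |∫ ω, Z ω ∂P - ∫ ω, W ω ∂P| := by
    intro ω
    have := abs_add_three (Z ω - W ω) (W ω - ∫ ω', W ω' ∂P) (∫ ω, W ω ∂P - ∫ ω, Z ω ∂P)
    rw [abs_sub_comm (∫ ω, W ω ∂P)] at this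
    refine le_trans (le_of_eq ?_) this
    congr 1
    ring
  have i1 := (hZ.sub hW).abs
  have i2 := (hW.sub (integrable_const (∫ ω', W ω' ∂P))).abs
  have i3 : Integrable (fun ω => |Z ω - W ω| + |W ω - ∫ ω', W ω' ∂P|) P := i1.add i2
  refine (integral_mono (hZ.sub (integrable_const _)).abs (i3.add (integrable_const _)) hb).trans ?_
  simp only [Pi.add_apply]
  have e : ∫ ω, (|Z ω - W ω| + |W ω - ∫ ω', W ω' ∂P|) ∂P =
      ∫ ω, |Z ω - W ω| ∂P + ∫ ω, |W ω - ∫ ω', W ω' ∂P| ∂P := integral_add i1 i2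
  rw [integral_add i3 (integrable_const _), e]
  simp only [integral_const, probReal_univ, one_smul]
  linarith

/-- The second spectral moment is a normalised Frobenius norm; an entry contributes at most `M²`
unless the Lindeberg sum counts it. With Chebyshev's inequality this yields the tail bounds below.
-/
theorem linStat_sq_normalized_le [NeZero n] (M : ℝ) (A : HermMat n) :
    linStat (fun x => x ^ 2) A.normalized ≤ M ^ 2 + largeEntrySum M A := by
  have hn : (0 : ℝ) < n := by exact_mod_cast Nat.pos_of_ne_zero (NeZero.ne n)
  have h1 : ∑ i, A.normalized.eig i ^ 2 =
      ∑ i, ∑ j, ‖(A.normalized : Matrix (Fin n) (Fin n) ℂ) i j‖ ^ 2 :=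
    sum_sq_eigenvalues A.normalized.isHermitian
  have h2 : ∀ i j, ‖(A.normalized : Matrix (Fin n) (Fin n) ℂ) i j‖ ^ 2 ≤
      (n : ℝ)⁻¹ * (M ^ 2 + if M < ‖(A : Matrix (Fin n) (Fin n) ℂ) i j‖ then
        ‖(A : Matrix (Fin n) (Fin n) ℂ) i j‖ ^ 2 else 0) := by
    intro i j
    change ‖((Real.sqrt n)⁻¹ : ℝ) • (A : Matrix (Fin n) (Fin n) ℂ) i j‖ ^ 2 ≤ _
    rw [norm_smul, mul_pow, Real.norm_eq_abs, sq_abs, inv_pow, Real.sq_sqrt (Nat.cast_nonneg n)]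
    refine mul_le_mul_of_nonneg_left ?_ (by positivity)
    split_ifs with h
    · nlinarith
    · rw [add_zero]
      exact pow_le_pow_left₀ (norm_nonneg _) (not_lt.1 h) 2
  have h3 := Finset.sum_le_sum fun i (_ : i ∈ Finset.univ) =>
    Finset.sum_le_sum fun j (_ : j ∈ Finset.univ) => h2 i j
  rw [linStat, h1]
  refine (mul_le_mul_of_nonneg_left h3 (by positivity)).trans_eq ?_
  simp only [← Finset.mul_sum, Finset.sum_add_distrib, largeEntrySum]
  simp only [Finset.sum_const, Finset.card_univ, Fintype.card_fin, nsmul_eq_mul]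
  field_simp

theorem esdMeasure_norm_gt_le [NeZero n] (M : ℝ) {R : ℝ} (hR : 0 < R)
    (A : HermMat n) :
    esdMeasure A.normalized {x | R < ‖x‖} ≤
      ENNReal.ofReal ((M ^ 2 + largeEntrySum M A) / R ^ 2) := by
  have hp := isProbabilityMeasure_esdMeasure A.normalized
  have hi : Integrable (fun x : ℝ => x ^ 2) (esdMeasure A.normalized) := by
    refine Integrable.smul_measure ?_ (by simp [NeZero.ne n])
    exact integrable_finsetSum_measure.2 fun i _ => integrable_dirac (by simp)
  have h := mul_meas_ge_le_integral_of_nonneg (Eventually.of_forall fun x => sq_nonneg x) hi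
    (R ^ 2)
  rw [integral_esdMeasure] at h
  have h' := h.trans (linStat_sq_normalized_le M A)
  rw [← ofReal_measureReal]
  refine ENNReal.ofReal_le_ofReal ?_
  rw [le_div_iff₀ (by positivity), mul_comm]
  refine le_trans (mul_le_mul_of_nonneg_left (measureReal_mono fun x hx => ?_) (by positivity)) h'
  have : R ≤ |x| := le_of_lt hx
  simpa using pow_le_pow_left₀ hR.le this 2

theorem expectedEsd_norm_gt_le {Ω : Type*} [MeasurableSpace Ω] {P : Measure Ω}
    [IsProbabilityMeasure P] [NeZero n] {X : Ω → HermMat n}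
    (hX : ∀ i j, Measurable fun ω => (X ω : Matrix (Fin n) (Fin n) ℂ) i j)
    (M : ℝ) {R : ℝ} (hR : 0 < R) :
    (expectedEsd P (fun ω => (X ω).normalized) (measurable_normalized hX) : Measure ℝ)
        {x | R < ‖x‖} ≤
      ENNReal.ofReal ((M ^ 2 + 1) / R ^ 2) + P {ω | 1 < largeEntrySum M (X ω)} := by
  have hS : MeasurableSet {ω | 1 < largeEntrySum M (X ω)} :=
    measurableSet_lt measurable_const (measurable_largeEntrySum hX M)
  rw [expectedEsd_apply P _ _ (measurableSet_lt measurable_const measurable_norm)]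
  have hb : ∀ ω, (esd (X ω).normalized : Measure ℝ) {x | R < ‖x‖} ≤
      ENNReal.ofReal ((M ^ 2 + 1) / R ^ 2) +
        {ω | 1 < largeEntrySum M (X ω)}.indicator 1 ω := by
    intro ω
    by_cases h : 1 < largeEntrySum M (X ω)
    · rw [Set.indicator_of_mem (by exact h)]
      exact prob_le_one.trans le_add_self
    · rw [Set.indicator_of_notMem (by exact h), add_zero]
      refine (esdMeasure_norm_gt_le M hR (X ω)).trans (ENNReal.ofReal_le_ofReal ?_)
      have := not_lt.1 h
      gcongr
  refine (lintegral_mono hb).trans_eq ?_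
  rw [lintegral_add_left measurable_const, lintegral_indicator_one hS]
  simp

theorem integral_expectedEsd {Ω : Type*} [MeasurableSpace Ω] {P : Measure Ω}
    [IsProbabilityMeasure P] [NeZero n] {X : Ω → HermMat n}
    (hX : ∀ i j, Measurable fun ω => (X ω : Matrix (Fin n) (Fin n) ℂ) i j)
    {f : ℝ → ℝ} (hf : Continuous f) {K : ℝ} (hK : ∀ a, |f a| ≤ K) :
    ∫ x, f x ∂(expectedEsd P X hX : Measure ℝ) = ∫ ω, linStat f (X ω) ∂P := by
  -- Viewing the mean measure as a composition of kernels gives access to Fubini for signed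
  -- integrands.
  let κ : Kernel Ω ℝ := ⟨fun ω => esdMeasure (X ω), measurable_esdMeasure hX⟩
  have hp : IsProbabilityMeasure (P.bind κ) := (expectedEsd P X hX).2
  have e : (κ ∘ₖ Kernel.const Unit P) () = P.bind κ := by
    rw [Kernel.comp_apply, Kernel.const_apply]
  have h := Kernel.integral_comp (κ := Kernel.const Unit P) (η := κ) (a := ()) (f := f) (by
    rw [e]
    exact Integrable.of_bound hf.measurable.aestronglyMeasurable K (Eventually.of_forall hK))
  rw [e, Kernel.const_apply] at h
  refine h.trans ?_
  congr 1
  funext ω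
  exact integral_esdMeasure (X ω) f

/-- Approximation of linear statistics, in mean. -/
theorem integral_abs_linStat_sub_le {Ω : Type*} [MeasurableSpace Ω] {P : Measure Ω}
    [IsProbabilityMeasure P] [NeZero n] {X : Ω → HermMat n}
    (hX : ∀ i j, Measurable fun ω => (X ω : Matrix (Fin n) (Fin n) ℂ) i j)
    {f g : ℝ → ℝ} (hf : Continuous f) (hg : Continuous g) {K η R : ℝ} (hη : 0 ≤ η)
    (hK : ∀ a, |f a - g a| ≤ K) (hR : ∀ a, ‖a‖ ≤ R → |f a - g a| ≤ η) :
    ∫ ω, |linStat f (X ω) - linStat g (X ω)| ∂P ≤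
      η + K * (expectedEsd P X hX : Measure ℝ).real {x | R < ‖x‖} := by
  have h1 : ∀ ω, |linStat f (X ω) - linStat g (X ω)| ≤ linStat (fun x => |f x - g x|) (X ω) := by
    intro ω
    rw [linStat, linStat, linStat, ← mul_sub, ← Finset.sum_sub_distrib, abs_mul, abs_inv,
      Nat.abs_cast]
    exact mul_le_mul_of_nonneg_left (Finset.abs_sum_le_sum_abs _ _) (by positivity)
  have hc : Continuous fun x => |f x - g x| := (hf.sub hg).abs
  have hK' : ∀ a, |(|f a - g a|)| ≤ K := fun a => by rw [abs_abs]; exact hK a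
  have hS : MeasurableSet {x : ℝ | R < ‖x‖} := measurableSet_lt measurable_const measurable_norm
  have hi := integrable_linStat (P := P) hX hc hK'
  have hm : Measurable fun ω => |linStat f (X ω) - linStat g (X ω)| :=
    ((measurable_linStat hX hf).sub (measurable_linStat hX hg)).abs
  have hi0 : Integrable (fun ω => |linStat f (X ω) - linStat g (X ω)|) P :=
    integrable_of_measurable_of_bounded hm (K := K) fun ω => by
      rw [abs_abs]
      exact (h1 ω).trans ((le_abs_self _).trans (abs_linStat_le hK' _))
  refine (integral_mono hi0 hi h1).trans ?_
  rw [← integral_expectedEsd hX hc hK']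
  have hi2 : Integrable ({x : ℝ | R < ‖x‖}.indicator fun _ => K)
    (expectedEsd P X hX : Measure ℝ) := (integrable_const _).indicator hS
  refine (integral_mono (integrable_of_measurable_of_bounded hc.measurable hK')
    ((integrable_const η).add hi2) fun x => ?_).trans_eq ?_
  · by_cases h : R < ‖x‖
    · simp only [Pi.add_apply]
      rw [Set.indicator_of_mem (by exact h)]
      linarith [hK x]
    · simp only [Pi.add_apply]
      rw [Set.indicator_of_notMem (by exact h), add_zero]
      exact hR x (not_lt.1 h)
  · simp only [Pi.add_apply]
    rw [integral_add (integrable_const _) hi2, integral_indicator_const _ hS]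
    simp [mul_comm]

end LinearStatistics

/-- Smooth compactly supported approximation of a bounded continuous function on a bounded
interval. -/
theorem exists_smooth_approx {f : ℝ → ℝ} (hf : Continuous f) {K : ℝ} (hK : ∀ a, |f a| ≤ K)
    {R : ℝ} (hR : 0 < R) {η : ℝ} (hη : 0 < η) :
    ∃ g g' : ℝ → ℝ, ∃ L C : ℝ, Continuous g ∧ 0 ≤ L ∧ (∀ a, |g a| ≤ K + η) ∧
      (∀ a, ‖a‖ ≤ R → |f a - g a| ≤ η) ∧ (∀ a b, |g b - g a| ≤ L * |b - a|) ∧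
      (∀ a, |g' a| ≤ L) ∧ ∀ a b, |g b - g a - g' a * (b - a)| ≤ C * (b - a) ^ 2 := by
  -- The approximation must hold on the whole support of the bump, of radius `R + 1`, to keep `|g| ≤
  -- K + η` in the transition zone.
  obtain ⟨p, hp⟩ := exists_polynomial_near_of_continuousOn (-(R + 1)) (R + 1) f
    hf.continuousOn η hη
  let χ : ContDiffBump (0 : ℝ) := ⟨R, R + 1, hR, by linarith⟩
  let g : ℝ → ℝ := fun x => χ x * p.eval x
  have hgs : ContDiff ℝ 2 g := χ.contDiff.mul (by simpa using p.contDiff_aeval (𝕜 := ℝ) 2)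
  have hgc : HasCompactSupport g := χ.hasCompactSupport.mul_right
  have hK0 : 0 ≤ K := (abs_nonneg _).trans (hK 0)
  obtain ⟨L, hL⟩ := hgs.lipschitzWith_of_hasCompactSupport hgc two_ne_zero
  have hg1 : ContDiff ℝ 1 (deriv g) :=
    (contDiff_succ_iff_deriv.1 (show ContDiff ℝ (1 + 1) g from hgs)).2.2
  obtain ⟨C, hC⟩ := hg1.lipschitzWith_of_hasCompactSupport hgc.deriv one_ne_zero
  have hC' : ∀ a b, |deriv g b - deriv g a| ≤ C * |b - a| := fun a b => by
    simpa [Real.dist_eq] using hC.dist_le_mul b a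
  have hd : Differentiable ℝ g := hgs.differentiable two_ne_zero
  refine ⟨g, deriv g, L, C, hgs.continuous, L.2, fun a => ?_, fun a ha => ?_, fun a b => ?_,
    fun a => ?_, fun a b => ?_⟩
  · by_cases h : |a| ≤ R + 1
    · have h1 := (hp a (abs_le.1 h)).le
      have h2 : |p.eval a| ≤ K + η := by
        have := abs_sub_abs_le_abs_sub (p.eval a) (f a)
        linarith [hK a]
      rw [abs_mul, abs_of_nonneg χ.nonneg]
      exact (mul_le_of_le_one_left (abs_nonneg _) χ.le_one).trans h2
    · have : χ a = 0 := χ.zero_of_le_dist (by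
        rw [Real.dist_eq, sub_zero]; exact (not_le.1 h).le)
      simp only [g, this, zero_mul, abs_zero]
      linarith
  · have h1 : χ a = 1 := χ.one_of_mem_closedBall (by simpa [Real.dist_eq] using! ha)
    have h2 : |a| ≤ R + 1 := le_trans ha (by linarith)
    simp only [g, h1, one_mul]
    rw [abs_sub_comm]
    exact (hp a (abs_le.1 h2)).le
  · simpa [Real.dist_eq] using hL.dist_le_mul b a
  · exact norm_deriv_le_of_lipschitz hL
  · have hder : ∀ x, HasDerivAt (fun x => g x - deriv g a * x) (deriv g x - deriv g a) x := by
      intro x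
      simpa using! (hd x).hasDerivAt.sub ((hasDerivAt_id x).const_mul (deriv g a))
    have h := Convex.norm_image_sub_le_of_norm_hasDerivWithin_le (s := Set.uIcc a b)
      (f := fun x => g x - deriv g a * x) (C := C * |b - a|)
      (fun x _ => (hder x).hasDerivWithinAt) (fun x hx => by
        refine (hC' a x).trans (mul_le_mul_of_nonneg_left ?_ C.2)
        exact Set.abs_sub_left_of_mem_uIcc hx)
      (convex_uIcc a b) Set.left_mem_uIcc Set.right_mem_uIcc
    rw [Real.norm_eq_abs, Real.norm_eq_abs, mul_assoc, ← sq, sq_abs] at h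
    refine le_trans (le_of_eq ?_) h
    congr 1
    ring

/-! ### Weak convergence in probability and compactness. -/

section WeakConvergence

/-- Sequential criterion for convergence along the weak topology. -/
theorem tendsto_of_weakTendsto {φ : ProbabilityMeasure ℝ → ℝ} {c : ℝ}
    {μ : ProbabilityMeasure ℝ}
    (h : ∀ u : ℕ → ProbabilityMeasure ℝ, WeakTendsto atTop u μ →
      Tendsto (fun k => φ (u k)) atTop (𝓝 c))
    {ι : Type*} {l : Filter ι} {u : ι → ProbabilityMeasure ℝ} (hu : WeakTendsto l u μ) :
    Tendsto (fun i => φ (u i)) l (𝓝 c) :=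
  -- Sequences suffice because `𝓝 μ` is countably generated, the weak topology on measures on `ℝ`
  -- being metrizable.
  (tendsto_of_seq_tendsto (f := φ) h).comp hu

theorem MetrizesWeakConvergence.tendsto_dist {D : MetricSpace (ProbabilityMeasure ℝ)}
    (hD : MetrizesWeakConvergence D) {μ : ProbabilityMeasure ℝ} {ι : Type*} {l : Filter ι}
    {u : ι → ProbabilityMeasure ℝ} (hu : WeakTendsto l u μ) :
    Tendsto (fun i => D.dist (u i) μ) l (𝓝 0) :=
  tendsto_of_weakTendsto (φ := fun ν => D.dist ν μ) (fun v hv => (hD v μ).1 hv) hu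

variable {Ω : ℕ+ → Type*} [∀ n, MeasurableSpace (Ω n)]

/-- The filter of the sets of probability measures that contain the random measure `ν n` with
probability tending to `1` along `l`. -/
def probFilter (P : ∀ n, Measure (Ω n)) (ν : ∀ n, Ω n → ProbabilityMeasure ℝ) (l : Filter ℕ+) :
    Filter (ProbabilityMeasure ℝ) where
  sets := {U | Tendsto (fun n => P n {ω | ν n ω ∉ U}) l (𝓝 0)}
  univ_sets := by simpa using tendsto_const_nhds
  sets_of_superset {U V} hU hUV := tendsto_of_tendsto_of_tendsto_of_le_of_le tendsto_const_nhds hU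
    (fun _ => zero_le) fun n => measure_mono fun _ hω h => hω (hUV h)
  inter_sets {U V} hU hV := by
    have h := Tendsto.add (show Tendsto (fun n => P n {ω | ν n ω ∉ U}) l (𝓝 0) from hU)
      (show Tendsto (fun n => P n {ω | ν n ω ∉ V}) l (𝓝 0) from hV)
    rw [add_zero] at h
    refine tendsto_of_tendsto_of_tendsto_of_le_of_le tendsto_const_nhds h
      (fun _ => zero_le) fun n => ?_
    refine le_trans (measure_mono fun ω hω => ?_) (measure_union_le _ _)
    by_contra hc
    simp only [Set.mem_union, Set.mem_ofPred_eq, not_or, not_not] at hc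
    exact hω hc

theorem mem_probFilter {P : ∀ n, Measure (Ω n)} {ν : ∀ n, Ω n → ProbabilityMeasure ℝ}
    {l : Filter ℕ+} {U : Set (ProbabilityMeasure ℝ)} :
    U ∈ probFilter P ν l ↔ Tendsto (fun n => P n {ω | ν n ω ∉ U}) l (𝓝 0) := Iff.rfl

/-- If the integrals of bounded continuous functions against `ν n` concentrate around those
against `m n`, and `m n` converges weakly to `μ`, then `ν n` is close to `μ` with high
probability. -/
theorem weakTendsto_probFilter {P : ∀ n, Measure (Ω n)}
    {ν : ∀ n, Ω n → ProbabilityMeasure ℝ} {m : ℕ+ → ProbabilityMeasure ℝ} {l : Filter ℕ+}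
    {μ : ProbabilityMeasure ℝ} (hm : WeakTendsto l m μ)
    (hν : ∀ f : BoundedContinuousFunction ℝ ℝ, ∀ ε : ℝ, 0 < ε →
      Tendsto (fun n => P n {ω | ε ≤ |∫ x, f x ∂(ν n ω : Measure ℝ) -
        ∫ x, f x ∂(m n : Measure ℝ)|}) l (𝓝 0)) :
    WeakTendsto (probFilter P ν l) id μ := by
  rw [weakTendsto_iff]
  intro f
  rw [Metric.tendsto_nhds]
  intro ε hε
  rw [Filter.Eventually, mem_probFilter]
  have h1 := (Metric.tendsto_nhds.1 (weakTendsto_iff.1 hm f)) (ε / 2) (half_pos hε)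
  refine tendsto_of_tendsto_of_tendsto_of_le_of_le' tendsto_const_nhds (hν f (ε / 2) (half_pos hε))
    (Eventually.of_forall fun _ => zero_le) ?_
  filter_upwards [h1] with n hn
  refine measure_mono fun ω hω => ?_
  simp only [Set.mem_ofPred_eq, not_lt, id_eq, Real.dist_eq] at hω hn ⊢
  have := abs_sub_le (∫ x, f x ∂(ν n ω : Measure ℝ)) (∫ x, f x ∂(m n : Measure ℝ))
    (∫ x, f x ∂(μ : Measure ℝ))
  linarith

/-- Along `probFilter`, convergence in probability is ordinary convergence, so the hypothesis on `D`
applies directly, with no measurability of the distance needed. -/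
theorem tendsto_measure_dist_of_weakTendsto_probFilter {P : ∀ n, Measure (Ω n)}
    {ν : ∀ n, Ω n → ProbabilityMeasure ℝ} {l : Filter ℕ+} {μ : ProbabilityMeasure ℝ}
    (h : WeakTendsto (probFilter P ν l) id μ) {D : MetricSpace (ProbabilityMeasure ℝ)}
    (hD : MetrizesWeakConvergence D) {ε : ℝ} (hε : 0 < ε) :
    Tendsto (fun n => P n {ω | ε < |D.dist (ν n ω) μ|}) l (𝓝 0) := by
  have h1 := mem_probFilter.1 (Metric.tendsto_nhds.1 (hD.tendsto_dist h) ε hε)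
  refine tendsto_of_tendsto_of_tendsto_of_le_of_le tendsto_const_nhds h1
    (fun _ => zero_le) fun n => measure_mono fun ω hω => ?_
  simp only [Set.mem_ofPred_eq, id_eq, Real.dist_eq, sub_zero, not_lt] at hω ⊢
  exact hω.le

/-- Prokhorov's theorem. Tail control for large `k` is enough, since tightness of a sequence can be
tested on a limsup. -/
theorem exists_weakTendsto_subseq {u : ℕ → ProbabilityMeasure ℝ}
    (hu : ∀ δ : ℝ≥0∞, 0 < δ → ∃ R : ℝ, ∀ᶠ k in atTop, (u k : Measure ℝ) {x | R < ‖x‖} ≤ δ) :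
    ∃ μ : ProbabilityMeasure ℝ, ∃ φ : ℕ → ℕ, StrictMono φ ∧ WeakTendsto atTop (u ∘ φ) μ := by
  have ht : IsTightMeasureSet (Set.range fun k => (u k : Measure ℝ)) := by
    refine isTightMeasureSet_range_of_tendsto_limsup_measure_norm_gt ?_
    rw [ENNReal.tendsto_nhds_zero]
    intro δ hδ
    obtain ⟨R, hR⟩ := hu δ hδ
    filter_upwards [eventually_ge_atTop R] with r hr
    refine limsup_le_of_le (by isBoundedDefault) ?_
    filter_upwards [hR] with k hk
    exact (measure_mono fun x hx => lt_of_le_of_lt hr hx).trans hk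
  have hc : IsCompact (closure (Set.range u)) := by
    refine isCompact_closure_of_isTightMeasureSet ?_
    convert ht using 1
    ext m
    simp
  obtain ⟨μ, -, φ, hφ, h⟩ := hc.tendsto_subseq fun k => subset_closure (Set.mem_range_self k)
  exact ⟨μ, φ, hφ, h⟩

end WeakConvergence

/-! ### Concentration under the Lindeberg and block hypotheses. -/

section Concentration

variable {Ω : ℕ+ → Type*} [∀ n, MeasurableSpace (Ω n)]
    {P : ∀ n, Measure (Ω n)} {X : ∀ n : ℕ+, Ω n → HermMat n}

theorem LindebergCondition.exists_eventually_le
    (hL : LindebergCondition P fun n ω => (X n ω : Matrix (Fin n) (Fin n) ℂ))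
    {ε : ℝ} (hε : 0 < ε) {δ : ℝ≥0∞} (hδ : 0 < δ) :
    ∃ M : ℝ, 0 ≤ M ∧ ∀ᶠ n : ℕ+ in atTop, P n {ω | ε < largeEntrySum M (X n ω)} ≤ δ := by
  obtain ⟨M, hM0, hM⟩ := ((eventually_ge_atTop (0 : ℝ)).and
    ((hL ε hε).eventually_lt_const hδ)).exists
  refine ⟨M, hM0, ?_⟩
  filter_upwards [eventually_lt_of_limsup_lt hM] with n hn
  refine le_trans (le_of_eq ?_) hn.le
  unfold largeEntrySum
  congr! 3

theorem LindebergCondition.exists_eventually_real_le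
    (hL : LindebergCondition P fun n ω => (X n ω : Matrix (Fin n) (Fin n) ℂ))
    {ε : ℝ} (hε : 0 < ε) {δ : ℝ} (hδ : 0 < δ) :
    ∃ M : ℝ, 0 ≤ M ∧ ∀ᶠ n : ℕ+ in atTop, (P n).real {ω | ε < largeEntrySum M (X n ω)} ≤ δ := by
  obtain ⟨M, hM0, hM⟩ := hL.exists_eventually_le hε (ENNReal.ofReal_pos.2 hδ)
  refine ⟨M, hM0, hM.mono fun n hn => ?_⟩
  exact ENNReal.toReal_le_of_le_ofReal hδ.le hn

variable [∀ n, IsProbabilityMeasure (P n)]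

theorem exists_expectedEsd_norm_gt_le
    (hX : ∀ (n : ℕ+) (i j : Fin n), Measurable fun ω => (X n ω : Matrix (Fin n) (Fin n) ℂ) i j)
    (hL : LindebergCondition P fun n ω => (X n ω : Matrix (Fin n) (Fin n) ℂ))
    {δ : ℝ≥0∞} (hδ : 0 < δ) :
    ∃ R : ℝ, 0 < R ∧ ∀ᶠ n : ℕ+ in atTop,
      (expectedEsd (P n) (fun ω => (X n ω).normalized) (measurable_normalized (hX n)) :
        Measure ℝ) {x | R < ‖x‖} ≤ δ := by
  obtain ⟨M, hM0, hM⟩ := hL.exists_eventually_le one_pos (ENNReal.half_pos hδ.ne')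
  have ht : Tendsto (fun R : ℝ => ENNReal.ofReal ((M ^ 2 + 1) / R ^ 2)) atTop (𝓝 0) := by
    have : Tendsto (fun R : ℝ => (M ^ 2 + 1) / R ^ 2) atTop (𝓝 0) :=
      tendsto_const_nhds.div_atTop (tendsto_pow_atTop two_ne_zero)
    simpa using ENNReal.tendsto_ofReal this
  obtain ⟨R, hR0, hR⟩ := ((eventually_gt_atTop (0 : ℝ)).and
    (ht.eventually_lt_const (ENNReal.half_pos hδ.ne'))).exists
  refine ⟨R, hR0, hM.mono fun n hn => ?_⟩
  refine (expectedEsd_norm_gt_le (hX n) M hR0).trans ?_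
  exact (add_le_add hR.le hn).trans_eq (ENNReal.add_halves δ)

/-- The truncation level is fixed before `n` grows: the variance bound carries `M⁴`, which is
harmless against `d n / n² → 0` once `M` is constant. -/
theorem tendsto_integral_abs_linStat_sub_of_smooth
    (hX : ∀ (n : ℕ+) (i j : Fin n), Measurable fun ω => (X n ω : Matrix (Fin n) (Fin n) ℂ) i j)
    {d : ℕ+ → ℝ} (hd : d =o[atTop] fun n : ℕ+ => ((n : ℕ) : ℝ) ^ 2)
    (hS : ∀ n, HasIndepBlocks (P n) (fun ω => (X n ω : Matrix (Fin n) (Fin n) ℂ)) (d n))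
    (hL : LindebergCondition P fun n ω => (X n ω : Matrix (Fin n) (Fin n) ℂ))
    {g g' : ℝ → ℝ} {K L C : ℝ} (hgc : Continuous g) (hL0 : 0 ≤ L) (hK : ∀ a, |g a| ≤ K)
    (hgL : ∀ a b, |g b - g a| ≤ L * |b - a|) (hg' : ∀ a, |g' a| ≤ L)
    (hC : ∀ a b, |g b - g a - g' a * (b - a)| ≤ C * (b - a) ^ 2) :
    Tendsto (fun n : ℕ+ => ∫ ω, |linStat g (X n ω).normalized -
      ∫ ω', linStat g (X n ω').normalized ∂P n| ∂P n) atTop (𝓝 0) := by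
  have hK0 : 0 ≤ K := (abs_nonneg _).trans (hK 0)
  rw [Metric.tendsto_nhds]
  intro ε hε
  -- Chosen so that `L √ε₁ ≤ ε / 8`. The total is then below `2 (ε/8 + ε/8) + ε/4`.
  set ε₁ : ℝ := (ε / (8 * (L + 1))) ^ 2 with hε₁
  have hε₁0 : 0 < ε₁ := by positivity
  obtain ⟨M, hM0, hM⟩ := hL.exists_eventually_real_le hε₁0
    (show 0 < ε / (16 * (K + 1)) by positivity)
  have hv : Tendsto (fun n : ℕ+ => Real.sqrt ((8 * L ^ 2 * M ^ 2 + 32 * C ^ 2 * M ^ 4) *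
      (d n / ((n : ℕ) : ℝ) ^ 2))) atTop (𝓝 0) := by
    have h := (hd.tendsto_div_nhds_zero.const_mul (8 * L ^ 2 * M ^ 2 + 32 * C ^ 2 * M ^ 4))
    rw [mul_zero] at h
    simpa using! (Real.continuous_sqrt.tendsto 0).comp h
  filter_upwards [hM, hv.eventually_lt_const (show 0 < ε / 4 by positivity)] with n hn1 hn2
  have i1 := integrable_linStat (P := P n) (measurable_normalized (hX n)) hgc hK
  have i2 := integrable_linStat (P := P n) (measurable_trunc_normalized (hX n) M) hgc hK
  have h1 := integral_abs_sub_integral_le i1 i2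
  have h2 := integral_abs_linStat_trunc_sub_le (P := P n) (hX n) hL0 hgc hK hgL M (ε := ε₁)
  have h3 : ∫ ω, |linStat g ((X n ω).trunc M).normalized -
      ∫ ω', linStat g ((X n ω').trunc M).normalized ∂P n| ∂P n ≤ _ :=
    integral_abs_trunc_sub_le (hX n) (hS n) hgc hK hC hg' hM0
  have h4 : L * Real.sqrt ε₁ ≤ ε / 8 := by
    rw [hε₁, Real.sqrt_sq (by positivity), ← mul_div_assoc, div_le_div_iff₀ (by positivity)
      (by positivity)]
    nlinarith
  have h5 : (K + K) * (P n).real {ω | ε₁ < largeEntrySum M (X n ω)} ≤ ε / 8 := by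
    refine (mul_le_mul_of_nonneg_left hn1 (by positivity)).trans ?_
    rw [← mul_div_assoc, div_le_div_iff₀ (by positivity) (by positivity)]
    nlinarith
  rw [Real.dist_eq, sub_zero, abs_of_nonneg (integral_nonneg fun ω => abs_nonneg _)]
  linarith

theorem tendsto_integral_abs_linStat_sub
    (hX : ∀ (n : ℕ+) (i j : Fin n), Measurable fun ω => (X n ω : Matrix (Fin n) (Fin n) ℂ) i j)
    {d : ℕ+ → ℝ} (hd : d =o[atTop] fun n : ℕ+ => ((n : ℕ) : ℝ) ^ 2)
    (hS : ∀ n, HasIndepBlocks (P n) (fun ω => (X n ω : Matrix (Fin n) (Fin n) ℂ)) (d n))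
    (hL : LindebergCondition P fun n ω => (X n ω : Matrix (Fin n) (Fin n) ℂ))
    {f : ℝ → ℝ} {K : ℝ} (hfc : Continuous f) (hK : ∀ a, |f a| ≤ K) :
    Tendsto (fun n : ℕ+ => ∫ ω, |linStat f (X n ω).normalized -
      ∫ ω', linStat f (X n ω').normalized ∂P n| ∂P n) atTop (𝓝 0) := by
  have hK0 : 0 ≤ K := (abs_nonneg _).trans (hK 0)
  rw [Metric.tendsto_nhds]
  intro ε hε
  -- `K + K + ε / 8` bounds `|f - g|` everywhere, so a tail of this mass costs at most `ε / 8`.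
  have hδ : 0 < ε / (8 * (K + K + ε / 8)) := by positivity
  obtain ⟨R, hR0, hR⟩ := exists_expectedEsd_norm_gt_le hX hL (ENNReal.ofReal_pos.2 hδ)
  obtain ⟨g, g', L, C, hgc, hL0, hgK, hfg, hgL, hg', hC⟩ :=
    exists_smooth_approx hfc hK hR0 (show 0 < ε / 8 by positivity)
  have hg := tendsto_integral_abs_linStat_sub_of_smooth hX hd hS hL hgc hL0 hgK hgL hg' hC
  filter_upwards [hR, hg.eventually_lt_const (show 0 < ε / 4 by positivity)] with n hn1 hn2
  have i1 := integrable_linStat (P := P n) (measurable_normalized (hX n)) hfc hK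
  have i2 := integrable_linStat (P := P n) (measurable_normalized (hX n)) hgc hgK
  have h1 := integral_abs_sub_integral_le i1 i2
  have h2 := integral_abs_linStat_sub_le (P := P n) (measurable_normalized (hX n)) hfc hgc
    (show 0 ≤ ε / 8 by positivity) (K := K + K + ε / 8)
    (fun a => ((abs_sub _ _).trans (add_le_add (hK a) (hgK a))).trans_eq (by ring)) hfg
  have h3 : (expectedEsd (P n) (fun ω => (X n ω).normalized) (measurable_normalized (hX n)) :
      Measure ℝ).real {x | R < ‖x‖} ≤ ε / (8 * (K + K + ε / 8)) :=
    ENNReal.toReal_le_of_le_ofReal hδ.le hn1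
  have h4 := mul_le_mul_of_nonneg_left h3 (show 0 ≤ K + K + ε / 8 by positivity)
  have h5 : (K + K + ε / 8) * (ε / (8 * (K + K + ε / 8))) = ε / 8 := by
    field_simp
  rw [Real.dist_eq, sub_zero, abs_of_nonneg (integral_nonneg fun ω => abs_nonneg _)]
  linarith

/-- Integrals against the empirical spectral distribution concentrate around their means. -/
theorem tendsto_measure_integral_esd_sub
    (hX : ∀ (n : ℕ+) (i j : Fin n), Measurable fun ω => (X n ω : Matrix (Fin n) (Fin n) ℂ) i j)
    {d : ℕ+ → ℝ} (hd : d =o[atTop] fun n : ℕ+ => ((n : ℕ) : ℝ) ^ 2)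
    (hS : ∀ n, HasIndepBlocks (P n) (fun ω => (X n ω : Matrix (Fin n) (Fin n) ℂ)) (d n))
    (hL : LindebergCondition P fun n ω => (X n ω : Matrix (Fin n) (Fin n) ℂ))
    (f : BoundedContinuousFunction ℝ ℝ) {ε : ℝ} (hε : 0 < ε) :
    Tendsto (fun n : ℕ+ => P n {ω | ε ≤ |∫ x, f x ∂(esd (X n ω).normalized : Measure ℝ) -
      ∫ x, f x ∂(expectedEsd (P n) (fun ω => (X n ω).normalized)
        (measurable_normalized (hX n)) : Measure ℝ)|}) atTop (𝓝 0) := by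
  have hK : ∀ a, |f a| ≤ ‖f‖ := fun a => f.norm_coe_le_norm a
  have h := (tendsto_integral_abs_linStat_sub hX hd hS hL f.continuous hK).div_const ε
  rw [zero_div] at h
  have h' := ENNReal.tendsto_ofReal h
  rw [ENNReal.ofReal_zero] at h'
  refine tendsto_of_tendsto_of_tendsto_of_le_of_le tendsto_const_nhds h'
    (fun _ => zero_le) fun n => ?_
  have e : ∀ ω, ∫ x, f x ∂(esd (X n ω).normalized : Measure ℝ) =
      linStat f (X n ω).normalized := fun ω => integral_esdMeasure _ f
  simp only [e, integral_expectedEsd (P := P n) (measurable_normalized (hX n)) f.continuous hK]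
  have hi := ((integrable_linStat (P := P n) (measurable_normalized (hX n)) f.continuous hK).sub
    (integrable_const (∫ ω', linStat f (X n ω').normalized ∂P n))).abs
  -- Markov's inequality converts the L¹ bound into one in probability.
  have hmk := mul_meas_ge_le_integral_of_nonneg
    (Eventually.of_forall fun ω => abs_nonneg _) hi ε
  rw [← ofReal_measureReal]
  refine ENNReal.ofReal_le_ofReal ?_
  rw [le_div_iff₀ hε, mul_comm]
  exact hmk

end Concentration

/-! ### Conclusion for arbitrary metrics. -/

theorem mainTheorem1 {Ω : ℕ+ → Type*} [∀ n, MeasurableSpace (Ω n)]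
    (P : ∀ n, Measure (Ω n)) [∀ n, IsProbabilityMeasure (P n)]
    (X : ∀ n : ℕ+, Ω n → HermMat n)
    (hX : ∀ n i j, Measurable fun ω => (X n ω : Matrix (Fin n) (Fin n) ℂ) i j)
    (d : ℕ+ → ℝ) (hd : d =o[atTop] fun n : ℕ+ => ((n : ℕ) : ℝ) ^ 2)
    (hS : ∀ n, HasIndepBlocks (P n) (fun ω => (X n ω : Matrix (Fin n) (Fin n) ℂ)) (d n))
    (hL : LindebergCondition P fun n ω => (X n ω : Matrix (Fin n) (Fin n) ℂ)) :
    (∀ D : MetricSpace (ProbabilityMeasure ℝ), MetrizesWeakConvergence D →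
      TendstoZeroInProbability P fun n ω =>
        D.dist (esd (X n ω).normalized)
          (expectedEsd (P n) (fun ω => (X n ω).normalized) (measurable_normalized (hX n)))) ∧
    (∀ μ : ProbabilityMeasure ℝ,
      WeakTendsto atTop (fun n : ℕ+ =>
        expectedEsd (P n) (fun ω => (X n ω).normalized) (measurable_normalized (hX n))) μ →
      TendstoWeaklyInProbability P (fun n ω => esd (X n ω).normalized) μ) := by
  -- A general filter `l` is allowed so that the same statement serves along subsequences.
  have key : ∀ (l : Filter ℕ+) (μ : ProbabilityMeasure ℝ), l ≤ atTop →
      WeakTendsto l (fun n : ℕ+ =>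
        expectedEsd (P n) (fun ω => (X n ω).normalized) (measurable_normalized (hX n))) μ →
      WeakTendsto (probFilter P (fun n ω => esd (X n ω).normalized) l) id μ :=
    fun l μ hl hμ => weakTendsto_probFilter hμ fun f ε hε =>
      (tendsto_measure_integral_esd_sub hX hd hS hL f hε).mono_left hl
  refine ⟨fun D hD ε hε => ?_, fun μ hμ D hD ε hε =>
    tendsto_measure_dist_of_weakTendsto_probFilter (key atTop μ le_rfl hμ) hD hε⟩
  -- `D` controls distances only near a fixed limit, whereas the mean measures need not converge.
  -- Along a further subsequence they do, and both measures are compared with that limit.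
  refine tendsto_of_subseq_tendsto fun ns hns => ?_
  obtain ⟨μ, φ, hφ, hμ⟩ := exists_weakTendsto_subseq (u := fun k =>
      expectedEsd (P (ns k)) (fun ω => (X (ns k) ω).normalized)
        (measurable_normalized (hX (ns k)))) fun δ hδ => by
    obtain ⟨R, -, hR⟩ := exists_expectedEsd_norm_gt_le hX hL hδ
    exact ⟨R, hns.eventually hR⟩
  refine ⟨φ, ?_⟩
  have hl : Tendsto (fun k => ns (φ k)) atTop atTop := hns.comp hφ.tendsto_atTop
  have h1 := tendsto_measure_dist_of_weakTendsto_probFilter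
    (key (map (fun k => ns (φ k)) atTop) μ hl (tendsto_map'_iff.2 hμ)) hD (half_pos hε)
  have h2 := (hD.tendsto_dist hμ).eventually_lt_const (half_pos hε)
  refine tendsto_of_tendsto_of_tendsto_of_le_of_le' tendsto_const_nhds (tendsto_map'_iff.1 h1)
    (Eventually.of_forall fun _ => zero_le) ?_
  filter_upwards [h2] with k hk
  refine measure_mono fun ω hω => ?_
  simp only [Set.mem_ofPred_eq, Function.comp_apply] at hω hk ⊢
  have ht := D.dist_triangle (esd (X (ns (φ k)) ω).normalized) μ
    (expectedEsd (P (ns (φ k))) (fun ω => (X (ns (φ k)) ω).normalized)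
      (measurable_normalized (hX (ns (φ k)))))
  rw [D.dist_comm μ] at ht
  rw [abs_of_nonneg (@dist_nonneg _ D.toPseudoMetricSpace _ _)] at hω ⊢
  linarith
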